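/- **Saturation of ultraproducts.** Conventions. A metric-measure language $L$ has constant symbols, function symbols and relation symbols of finite arity $\ge 1$, a bound $b_R\ge 0$ for each relation symbol $R$, a modulus of uniform continuity $\Delta:(0,\infty)\to(0,\infty)$ for each function and relation symbol, and a distinguished metric symbol $\rho$. A metric-measure $L$-structure is a nonempty metric space $(M,\rho)$ of diameter at most $1$ with a Borel measure $\mu$, $\mu(M)\le 1$, and interpretations $c^M\in M$, $F^M:M^n\to M$, $R^M:M^n\to[-b_R,b_R]$ that are uniformly continuous with the given moduli ($d(\bar x,\bar y)<\Delta(\epsilon)$ implies that the values differ by at most $\epsilon$, with the maximum metric on $M^n$). Formulas are built from $1$, $\rho(s,t)$ and $R(t_1,\dots,t_n)$ ($s,t,t_i$ terms) by $+$, $\wedge$ (minimum), multiplication by real scalars, $\sup_x$ and $\int\cdot\,dx$, interpreted in the obvious way. A statement is an expression $\varphi=\psi$ or $\varphi\le\psi$. For $A\subseteq M$, an $n$-type over $A$ is a set of statements in $x_1,\dots,x_n$ with parameters in $A$ each finite subset of which can, for every $\epsilon>0$, be satisfied in $M$ up to an error $\epsilon$; $M$ is $\kappa$-saturated if for every $A\subseteq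 M$ with $|A|<\kappa$ and every $n$, every $n$-type over $A$ is realized in $M$. Let $(M_i)_{i\in I}$ be metric-measure $L$-structures and $\mathcal D$ an ultrafilter on $I$. Let $M$ be the set-theoretic ultraproduct, with the pseudometric $\rho([a_i],[b_i])=\lim_{\mathcal D}\rho_i(a_i,b_i)$ and the measure $\mu$ on the $\sigma$-algebra generated by the ultraboxes $[A_i]=\{[a_i]:\{i:a_i\in A_i\}\in\mathcal D\}$ ($A_i\subseteq M_i$ Borel) that is the Carathéodory extension of $[A_i]\mapsto\lim_{\mathcal D}\mu_i(A_i)$. Let $\pi:M\to\hat M$ be the quotient by $\rho(a,b)=0$, with the induced metric and the interpretations $c=\pi[c^{M_i}]$, $F(\pi[a^1_i],\dots,\pi[a^n_i])=\pi[F^{M_i}(a^1_i,\dots,a^n_i)]$, $R(\pi[a^1_i],\dots,\pi[a^n_i])=\lim_{\mathcal D}R^{M_i}(a^1_i,\dots,a^n_i)$. A Borel measure is $\tau$-additive if it commutes with unions of upward directed families of open sets. The ultraproduct $\prod_{\mathcal D}M_i$ is $\hat M$ with the $\tau$-additive Borel measure $\hat\mu$ such that $\hat\mu(B)=\mu(\pi^{-1}(B))$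 for every $B$ in the $\sigma$-algebra generated by the open balls of $\hat M$; such a $\hat\mu$ is unique if it exists, and the ultraproduct is defined when it exists. **Proposition.** Let $L$ be a countable language and $\mathcal D$ a countably incomplete ultrafilter on $I$. Then, for every family $(M_i)_{i\in I}$ of metric-measure $L$-structures for which the ultraproduct $\prod_{\mathcal D}M_i$ is defined, $\prod_{\mathcal D}M_i$ is $\aleph_1$-saturated. -/

import Mathlib

open MeasureTheory Filter Topology
open scoped ENNReal Cardinal

universe u v w x

namespace ContIntLogic

/-! ### Syntax -/

/-- A metric-measure language: constant, function and relation symbols, with arities (at least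
one) for function and relation symbols, a bound for every relation symbol, and a modulus of
uniform continuity `(0, ∞) → (0, ∞)` for every function and relation symbol (only the values of
the modulus at positive arguments matter). The distinguished binary metric symbol `ρ` and the
measure symbol are present in every language, hence not listed. -/
structure MMLanguage where
  Const : Type u
  Func : Type u
  Rel : Type u
  funcArity : Func → ℕ
  funcArity_pos : ∀ F, 1 ≤ funcArity F
  relArity : Rel → ℕ
  relArity_pos : ∀ R, 1 ≤ relArity R
  relBound : Rel → ℝ
  relBound_nonneg : ∀ R, 0 ≤ relBound R
  funcMod : Func → ℝ → ℝ
  funcMod_pos : ∀ F ε, 0 < ε → 0 < funcMod F ε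
  relMod : Rel → ℝ → ℝ
  relMod_pos : ∀ R ε, 0 < ε → 0 < relMod R ε

/-- The language has countably many symbols. -/
def MMLanguage.IsCountable (L : MMLanguage.{u}) : Prop :=
  Countable L.Const ∧ Countable L.Func ∧ Countable L.Rel

/-- Terms with variables in `α`. -/
inductive Term (L : MMLanguage.{u}) (α : Type v) : Type (max u v)
  | var (a : α) : Term L α
  | const (c : L.Const) : Term L α
  | func (F : L.Func) (ts : Fin (L.funcArity F) → Term L α) : Term L α

/-- Formulas with free variables in `α` and `k` further variables that are available for
quantification. The quantifiers `sup` and `integral` bind the last of these. -/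
inductive Formula (L : MMLanguage.{u}) (α : Type v) : ℕ → Type (max u v)
  | one {k : ℕ} : Formula L α k
  | rho {k : ℕ} (s t : Term L (α ⊕ Fin k)) : Formula L α k
  | rel {k : ℕ} (R : L.Rel) (ts : Fin (L.relArity R) → Term L (α ⊕ Fin k)) : Formula L α k
  | smul {k : ℕ} (r : ℝ) (φ : Formula L α k) : Formula L α k
  | add {k : ℕ} (φ ψ : Formula L α k) : Formula L α k
  | min {k : ℕ} (φ ψ : Formula L α k) : Formula L α k
  | sup {k : ℕ} (φ : Formula L α (k + 1)) : Formula L α k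
  | integral {k : ℕ} (φ : Formula L α (k + 1)) : Formula L α k

/-! ### Semantics -/

/-- A metric-measure `L`-structure: a nonempty metric space of diameter at most one with
interpretations of the symbols that respect bounds and moduli (finite powers carry the maximum
metric), and a Borel measure of total mass at most one. -/
structure MMStructure (L : MMLanguage.{u}) where
  carrier : Type w
  [metric : MetricSpace carrier]
  [measurable : MeasurableSpace carrier]
  [borel : BorelSpace carrier]
  [nonempty : Nonempty carrier]
  dist_le_one : ∀ a b : carrier, dist a b ≤ 1
  const : L.Const → carrier
  func : ∀ F : L.Func, (Fin (L.funcArity F) → carrier) → carrier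
  rel : ∀ R : L.Rel, (Fin (L.relArity R) → carrier) → ℝ
  func_unif : ∀ F ε, 0 < ε → ∀ a b : Fin (L.funcArity F) → carrier,
    dist a b < L.funcMod F ε → dist (func F a) (func F b) ≤ ε
  rel_unif : ∀ R ε, 0 < ε → ∀ a b : Fin (L.relArity R) → carrier,
    dist a b < L.relMod R ε → |rel R a - rel R b| ≤ ε
  abs_rel_le : ∀ R a, |rel R a| ≤ L.relBound R
  μ : Measure carrier
  μ_univ_le : μ Set.univ ≤ 1

attribute [instance] MMStructure.metric MMStructure.measurable MMStructure.borel
  MMStructure.nonempty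

variable {L : MMLanguage.{u}}

/-- The interpretation of a term under an assignment. -/
def Term.eval (M : MMStructure.{u, w} L) {α : Type v} (a : α → M.carrier) :
    Term L α → M.carrier
  | .var x => a x
  | .const c => M.const c
  | .func F ts => M.func F (fun k => (ts k).eval M a)

/-- The interpretation of a formula under an assignment. -/
noncomputable def Formula.eval (M : MMStructure.{u, w} L) {α : Type v} (a : α → M.carrier) :
    {k : ℕ} → Formula L α k → (Fin k → M.carrier) → ℝ
  | _, .one, _ => 1
  | _, .rho s t, b => dist (s.eval M (Sum.elim a b)) (t.eval M (Sum.elim a b))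
  | _, .rel R ts, b => M.rel R (fun j => (ts j).eval M (Sum.elim a b))
  | _, .smul r φ, b => r * φ.eval M a b
  | _, .add φ ψ, b => φ.eval M a b + ψ.eval M a b
  | _, .min φ ψ, b => Min.min (φ.eval M a b) (ψ.eval M a b)
  | _, .sup φ, b => ⨆ y : M.carrier, φ.eval M a (Fin.snoc b y)
  | _, .integral φ, b => ∫ y : M.carrier, φ.eval M a (Fin.snoc b y) ∂M.μ

/-- Statements `φ = ψ` and `φ ≤ ψ` about the free variables in `α`. -/
inductive Condition (L : MMLanguage.{u}) (α : Type v) : Type (max u v)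
  | eq (φ ψ : Formula L α 0) : Condition L α
  | le (φ ψ : Formula L α 0) : Condition L α

/-- The statement holds up to an error of at most `ε`. -/
def Condition.HoldsUpTo (M : MMStructure.{u, w} L) {α : Type v} (ε : ℝ) (a : α → M.carrier) :
    Condition L α → Prop
  | .eq φ ψ => |φ.eval M a Fin.elim0 - ψ.eval M a Fin.elim0| ≤ ε
  | .le φ ψ => φ.eval M a Fin.elim0 ≤ ψ.eval M a Fin.elim0 + ε

/-- The statement holds. -/
def Condition.Holds (M : MMStructure.{u, w} L) {α : Type v} (a : α → M.carrier) :
    Condition L α → Prop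
  | .eq φ ψ => φ.eval M a Fin.elim0 = ψ.eval M a Fin.elim0
  | .le φ ψ => φ.eval M a Fin.elim0 ≤ ψ.eval M a Fin.elim0

/-- `p` is an `n`-type over the parameter set `A` of `M`: a set of statements with parameters in
`A` in the variables `x₁, …, xₙ` that is finitely approximately satisfiable in `M`. (Sets of
statements which are finitely satisfiable in `M`, or which are realized in some elementary
extension of `M`, have this property.) -/
def IsTypeOver (M : MMStructure.{u, w} L) (A : Set M.carrier) (n : ℕ)
    (p : Set (Condition L (A ⊕ Fin n))) : Prop :=
  ∀ p₀ : Finset (Condition L (A ⊕ Fin n)), (p₀ : Set (Condition L (A ⊕ Fin n))) ⊆ p →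
    ∀ ε : ℝ, 0 < ε → ∃ b : Fin n → M.carrier,
      ∀ σ ∈ p₀, σ.HoldsUpTo M ε (Sum.elim (fun a : A => (a : M.carrier)) b)

/-- `M` is `κ`-saturated: every type in finitely many variables over a set of fewer than `κ`
parameters is realized in `M`. -/
def IsSaturated (κ : Cardinal.{w}) (M : MMStructure.{u, w} L) : Prop :=
  ∀ A : Set M.carrier, #A < κ → ∀ (n : ℕ) (p : Set (Condition L (A ⊕ Fin n))),
    IsTypeOver M A n p → ∃ b : Fin n → M.carrier,
      ∀ σ ∈ p, σ.Holds M (Sum.elim (fun a : A => (a : M.carrier)) b)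

/-! ### Ultrafilters and ultralimits -/

variable {I : Type v}

/-- An ultrafilter is countably incomplete if it is not closed under countable intersections. -/
def IsCountablyIncomplete (D : Ultrafilter I) : Prop :=
  ∃ s : ℕ → Set I, (∀ n, s n ∈ D) ∧ (⋂ n, s n) ∉ D

/-- The limit of `f` along the ultrafilter `D`. -/
noncomputable def ulim {X : Type x} [TopologicalSpace X] [Nonempty X] (D : Ultrafilter I)
    (f : I → X) : X :=
  limUnder (D : Filter I) f

theorem tendsto_ulim_of_isCompact {X : Type x} [TopologicalSpace X] [Nonempty X]
    (D : Ultrafilter I) (f : I → X) {K : Set X} (hK : IsCompact K) (hf : ∀ i, f i ∈ K) :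
    Tendsto f D (𝓝 (ulim D f)) := by
  obtain ⟨z, -, hz⟩ := hK.ultrafilter_le_nhds (D.map f)
    (le_principal_iff.2 (Filter.mem_map.2 (Filter.univ_mem' hf)))
  exact tendsto_nhds_limUnder ⟨z, hz⟩

theorem tendsto_ulim_real (D : Ultrafilter I) (f : I → ℝ) {c : ℝ} (hf : ∀ i, |f i| ≤ c) :
    Tendsto f D (𝓝 (ulim D f)) :=
  tendsto_ulim_of_isCompact D f (isCompact_Icc (a := -c) (b := c)) fun i => abs_le.1 (hf i)

theorem tendsto_ulim_ennreal (D : Ultrafilter I) (f : I → ℝ≥0∞) :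
    Tendsto f D (𝓝 (ulim D f)) :=
  tendsto_ulim_of_isCompact D f isCompact_univ fun _ => Set.mem_univ _

theorem ulim_congr {X : Type x} [TopologicalSpace X] [Nonempty X] (D : Ultrafilter I)
    {f g : I → X} (h : f =ᶠ[(D : Filter I)] g) : ulim D f = ulim D g := by
  unfold ulim limUnder
  rw [Filter.map_congr h]

/-! ### The set theoretic ultraproduct, its pseudometric and its measure -/

variable (D : Ultrafilter I) (M : I → MMStructure.{u, w} L)

/-- The set theoretic ultraproduct: families modulo equality on a set in `D`. -/
def UProd : Type (max v w) := (D : Filter I).Product (fun i => (M i).carrier)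

/-- The class `[aᵢ]` of a family. -/
def UProd.mk (a : ∀ i, (M i).carrier) : UProd D M :=
  Quotient.mk (Filter.productSetoid (D : Filter I) fun i => (M i).carrier) a

theorem UProd.mk_surjective : Function.Surjective (UProd.mk D M) := Quotient.mk_surjective

theorem tendsto_dist (a b : ∀ i, (M i).carrier) :
    Tendsto (fun i => dist (a i) (b i)) D (𝓝 (ulim D fun i => dist (a i) (b i))) :=
  tendsto_ulim_real D _ fun i => (abs_of_nonneg dist_nonneg).trans_le ((M i).dist_le_one _ _)

/-- `ρ([aᵢ], [bᵢ]) = lim_D ρᵢ(aᵢ, bᵢ)`. -/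
noncomputable def UProd.rho (x y : UProd D M) : ℝ :=
  Quotient.liftOn₂ x y (fun a b => ulim D fun i => dist (a i) (b i)) (by
    intro a b a' b' ha hb
    refine ulim_congr D ?_
    filter_upwards [ha, hb] with i h1 h2
    rw [h1, h2])

noncomputable instance UProd.instPseudoMetricSpace : PseudoMetricSpace (UProd D M) where
  dist := UProd.rho D M
  dist_self := by
    rintro ⟨a⟩
    exact tendsto_nhds_unique (tendsto_dist D M a a) (by simp)
  dist_comm := by
    rintro ⟨a⟩ ⟨b⟩
    exact congrArg (ulim D) (funext fun i => dist_comm _ _)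
  dist_triangle := by
    rintro ⟨a⟩ ⟨b⟩ ⟨c⟩
    exact le_of_tendsto_of_tendsto' (tendsto_dist D M a c)
      ((tendsto_dist D M a b).add (tendsto_dist D M b c)) fun i => dist_triangle _ _ _

/-- The ultrabox `[Aᵢ] = {[aᵢ] : aᵢ ∈ Aᵢ for D-almost all i}`. -/
def ultrabox (A : ∀ i, Set (M i).carrier) : Set (UProd D M) :=
  {x | ∃ a : ∀ i, (M i).carrier, UProd.mk D M a = x ∧ ∀ᶠ i in (D : Filter I), a i ∈ A i}

/-- The `σ`-algebra generated by the ultraboxes of families of measurable sets. -/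
instance UProd.instMeasurableSpace : MeasurableSpace (UProd D M) :=
  MeasurableSpace.generateFrom
    {S | ∃ A : ∀ i, Set (M i).carrier, (∀ i, MeasurableSet (A i)) ∧ S = ultrabox D M A}

/-- The set function with `[Aᵢ] ↦ lim_D μᵢ(Aᵢ)` on ultraboxes of measurable sets (the limit does
not depend on the representing family), and `∞` on all other sets. -/
noncomputable def ultraPremeasure (S : Set (UProd D M)) : ℝ≥0∞ :=
  ⨅ (A : ∀ i, Set (M i).carrier) (_ : ∀ i, MeasurableSet (A i)) (_ : S = ultrabox D M A),
    ulim D fun i => (M i).μ (A i)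

theorem mk_mem_ultrabox (A : ∀ i, Set (M i).carrier) (a : ∀ i, (M i).carrier) :
    UProd.mk D M a ∈ ultrabox D M A ↔ ∀ᶠ i in (D : Filter I), a i ∈ A i := by
  constructor
  · rintro ⟨b, hb, h⟩
    have hb' : ∀ᶠ i in (D : Filter I), b i = a i := Quotient.exact hb
    filter_upwards [hb', h] with i h1 h2
    rwa [← h1]
  · exact fun h => ⟨a, rfl, h⟩

theorem ultrabox_empty : ultrabox D M (fun _ => ∅) = ∅ := by
  ext x
  obtain ⟨a, rfl⟩ := UProd.mk_surjective D M x
  simp [mk_mem_ultrabox, D.neBot.ne]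

theorem ultrabox_univ : ultrabox D M (fun _ => Set.univ) = Set.univ := by
  ext x
  obtain ⟨a, rfl⟩ := UProd.mk_surjective D M x
  simp [mk_mem_ultrabox]

theorem ultrabox_inter (A B : ∀ i, Set (M i).carrier) :
    ultrabox D M A ∩ ultrabox D M B = ultrabox D M fun i => A i ∩ B i := by
  ext x
  obtain ⟨a, rfl⟩ := UProd.mk_surjective D M x
  simp [mk_mem_ultrabox]

theorem ultrabox_diff (A B : ∀ i, Set (M i).carrier) :
    ultrabox D M A \ ultrabox D M B = ultrabox D M fun i => A i \ B i := by
  ext x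
  obtain ⟨a, rfl⟩ := UProd.mk_surjective D M x
  simp only [Set.mem_sdiff, mk_mem_ultrabox, eventually_and, Ultrafilter.eventually_not]

theorem ultraPremeasure_empty : ultraPremeasure D M ∅ = 0 := by
  refine le_antisymm ?_ bot_le
  refine iInf_le_of_le (fun _ => ∅) (iInf_le_of_le (fun _ => MeasurableSet.empty)
    (iInf_le_of_le (ultrabox_empty D M).symm ?_))
  exact (tendsto_nhds_unique (tendsto_ulim_ennreal D _) (by simp)).le

theorem ultrabox_le_caratheodory :
    UProd.instMeasurableSpace D M ≤
      (OuterMeasure.ofFunction (ultraPremeasure D M) (ultraPremeasure_empty D M)).caratheodory := by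
  refine MeasurableSpace.generateFrom_le ?_
  rintro _ ⟨B, hB, rfl⟩
  refine OuterMeasure.ofFunction_caratheodory fun t => ?_
  refine le_iInf fun A => le_iInf fun hA => le_iInf fun ht => ?_
  subst ht
  have h1 : ultraPremeasure D M (ultrabox D M A ∩ ultrabox D M B) ≤
      ulim D fun i => (M i).μ (A i ∩ B i) :=
    iInf_le_of_le _ (iInf_le_of_le (fun i => (hA i).inter (hB i))
      (iInf_le_of_le (ultrabox_inter D M A B) le_rfl))
  have h2 : ultraPremeasure D M (ultrabox D M A \ ultrabox D M B) ≤
      ulim D fun i => (M i).μ (A i \ B i) :=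
    iInf_le_of_le _ (iInf_le_of_le (fun i => (hA i).diff (hB i))
      (iInf_le_of_le (ultrabox_diff D M A B) le_rfl))
  refine (add_le_add h1 h2).trans (le_of_eq ?_)
  refine tendsto_nhds_unique ((tendsto_ulim_ennreal D _).add (tendsto_ulim_ennreal D _)) ?_
  refine (tendsto_ulim_ennreal D fun i => (M i).μ (A i)).congr fun i => ?_
  exact (measure_inter_add_sdiff _ (hB i)).symm

/-- The ultraproduct measure on the `σ`-algebra generated by the ultraboxes: the Carathéodory
extension of `[Aᵢ] ↦ lim_D μᵢ(Aᵢ)`. -/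
noncomputable def ultraMeasure : Measure (UProd D M) :=
  (OuterMeasure.ofFunction (ultraPremeasure D M) (ultraPremeasure_empty D M)).toMeasure
    (ultrabox_le_caratheodory D M)

theorem ultraMeasure_univ_le : ultraMeasure D M Set.univ ≤ 1 := by
  unfold ultraMeasure
  rw [toMeasure_apply _ _ MeasurableSet.univ]
  refine (OuterMeasure.ofFunction_le _).trans ?_
  refine iInf_le_of_le (fun _ => Set.univ) (iInf_le_of_le (fun _ => MeasurableSet.univ)
    (iInf_le_of_le (ultrabox_univ D M).symm ?_))
  exact le_of_tendsto' (tendsto_ulim_ennreal D _) fun i => (M i).μ_univ_le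

/-! ### The metric ultraproduct -/

/-- The metric space associated with the set theoretic ultraproduct and its pseudometric. -/
def UHat : Type (max v w) := SeparationQuotient (UProd D M)

noncomputable instance UHat.instMetricSpace : MetricSpace (UHat D M) :=
  inferInstanceAs (MetricSpace (SeparationQuotient (UProd D M)))

noncomputable instance UHat.instMeasurableSpace : MeasurableSpace (UHat D M) := borel _

instance UHat.instBorelSpace : BorelSpace (UHat D M) := ⟨rfl⟩

/-- The quotient map `π` from the set theoretic ultraproduct. -/
noncomputable def UHat.proj : UProd D M → UHat D M := SeparationQuotient.mk

/-- The point `π [aᵢ]`. -/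
noncomputable def UHat.mk (a : ∀ i, (M i).carrier) : UHat D M := UHat.proj D M (UProd.mk D M a)

theorem UHat.mk_surjective : Function.Surjective (UHat.mk D M) :=
  SeparationQuotient.surjective_mk.comp (UProd.mk_surjective D M)

theorem UHat.dist_mk (a b : ∀ i, (M i).carrier) :
    dist (UHat.mk D M a) (UHat.mk D M b) = ulim D fun i => dist (a i) (b i) := rfl

instance UHat.instNonempty : Nonempty (UHat D M) := ⟨UHat.mk D M fun _ => Classical.arbitrary _⟩

/-- A representing family of a point. -/
noncomputable def UHat.rep (x : UHat D M) : ∀ i, (M i).carrier :=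
  Function.surjInv (UHat.mk_surjective D M) x

theorem UHat.mk_rep (x : UHat D M) : UHat.mk D M (UHat.rep D M x) = x :=
  Function.surjInv_eq _ x

/-- The interpretation of a function symbol, computed on representing families. -/
noncomputable def UHat.func (F : L.Func) (x : Fin (L.funcArity F) → UHat D M) : UHat D M :=
  UHat.mk D M fun i => (M i).func F fun k => UHat.rep D M (x k) i

/-- The interpretation of a relation symbol, computed on representing families. -/
noncomputable def UHat.rel (R : L.Rel) (x : Fin (L.relArity R) → UHat D M) : ℝ :=
  ulim D fun i => (M i).rel R fun k => UHat.rep D M (x k) i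

theorem eventually_dist_lt {n : ℕ} {δ : ℝ} (hδ : 0 < δ) (a b : Fin n → ∀ i, (M i).carrier)
    (h : dist (fun k => UHat.mk D M (a k)) (fun k => UHat.mk D M (b k)) < δ) :
    ∀ᶠ i in (D : Filter I), dist (fun k => a k i) (fun k => b k i) < δ := by
  rw [dist_pi_lt_iff hδ] at h
  have h' : ∀ k, ∀ᶠ i in (D : Filter I), dist (a k i) (b k i) < δ := fun k =>
    (tendsto_dist D M (a k) (b k)).eventually_lt_const (h k)
  filter_upwards [eventually_all.2 h'] with i hi
  exact (dist_pi_lt_iff hδ).2 hi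

theorem dist_func_le (F : L.Func) (ε : ℝ) (hε : 0 < ε)
    (a b : Fin (L.funcArity F) → ∀ i, (M i).carrier)
    (h : dist (fun k => UHat.mk D M (a k)) (fun k => UHat.mk D M (b k)) < L.funcMod F ε) :
    dist (UHat.mk D M fun i => (M i).func F fun k => a k i)
      (UHat.mk D M fun i => (M i).func F fun k => b k i) ≤ ε := by
  rw [UHat.dist_mk]
  refine le_of_tendsto (tendsto_dist D M _ _) ?_
  filter_upwards [eventually_dist_lt D M (L.funcMod_pos F ε hε) a b h] with i hi
  exact (M i).func_unif F ε hε _ _ hi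

theorem tendsto_rel (R : L.Rel) (a : Fin (L.relArity R) → ∀ i, (M i).carrier) :
    Tendsto (fun i => (M i).rel R fun k => a k i) D
      (𝓝 (ulim D fun i => (M i).rel R fun k => a k i)) :=
  tendsto_ulim_real D _ fun i => (M i).abs_rel_le R _

theorem abs_rel_sub_le (R : L.Rel) (ε : ℝ) (hε : 0 < ε)
    (a b : Fin (L.relArity R) → ∀ i, (M i).carrier)
    (h : dist (fun k => UHat.mk D M (a k)) (fun k => UHat.mk D M (b k)) < L.relMod R ε) :
    |(ulim D fun i => (M i).rel R fun k => a k i) -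
      ulim D fun i => (M i).rel R fun k => b k i| ≤ ε := by
  refine le_of_tendsto ((tendsto_rel D M R a).sub (tendsto_rel D M R b)).abs ?_
  filter_upwards [eventually_dist_lt D M (L.relMod_pos R ε hε) a b h] with i hi
  exact (M i).rel_unif R ε hε _ _ hi

/-- `F (π[aᵢ¹], …, π[aᵢⁿ]) = π[F (aᵢ¹, …, aᵢⁿ)]`. -/
theorem UHat.func_mk (F : L.Func) (a : Fin (L.funcArity F) → ∀ i, (M i).carrier) :
    UHat.func D M F (fun k => UHat.mk D M (a k)) =
      UHat.mk D M fun i => (M i).func F fun k => a k i := by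
  refine dist_le_zero.1 (le_of_forall_pos_le_add fun ε hε => ?_)
  rw [zero_add]
  refine dist_func_le D M F ε hε _ a ?_
  simp only [UHat.mk_rep, dist_self]
  exact L.funcMod_pos F ε hε

/-- `R (π[aᵢ¹], …, π[aᵢⁿ]) = lim_D R (aᵢ¹, …, aᵢⁿ)`. -/
theorem UHat.rel_mk (R : L.Rel) (a : Fin (L.relArity R) → ∀ i, (M i).carrier) :
    UHat.rel D M R (fun k => UHat.mk D M (a k)) =
      ulim D fun i => (M i).rel R fun k => a k i := by
  refine sub_eq_zero.1 (abs_nonpos_iff.1 (le_of_forall_pos_le_add fun ε hε => ?_))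
  rw [zero_add]
  refine abs_rel_sub_le D M R ε hε _ a ?_
  simp only [UHat.mk_rep, dist_self]
  exact L.relMod_pos R ε hε

/-! ### The metric-measure ultraproduct -/

/-- A Borel measure is `τ`-additive if it commutes with upward directed unions of open sets. -/
def IsTauAdditive {X : Type x} [TopologicalSpace X] [MeasurableSpace X] (ν : Measure X) : Prop :=
  ∀ 𝒰 : Set (Set X), (∀ U ∈ 𝒰, IsOpen U) → DirectedOn (· ⊆ ·) 𝒰 →
    ν (⋃₀ 𝒰) = ⨆ U ∈ 𝒰, ν U

/-- The Borel measure `ν` on the metric ultraproduct is the ultraproduct of the measures: it is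
`τ`-additive and extends the restriction to the `σ`-algebra generated by the open balls of the
push forward under `π` of the measure on the set theoretic ultraproduct. -/
def IsUltraproductMeasure (ν : Measure (UHat D M)) : Prop :=
  IsTauAdditive ν ∧
    ∀ B : Set (UHat D M),
      MeasurableSet[MeasurableSpace.generateFrom
        {S : Set (UHat D M) | ∃ c r, S = Metric.ball c r}] B →
      ν B = ultraMeasure D M (UHat.proj D M ⁻¹' B)

/-- The ultraproduct `∏_D Mᵢ`, for the measure `ν` that the measures of the `Mᵢ` determine. -/
noncomputable def ultraproduct (ν : Measure (UHat D M)) (hν : IsUltraproductMeasure D M ν) :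
    MMStructure.{u, max v w} L where
  carrier := UHat D M
  dist_le_one x y := by
    rw [← UHat.mk_rep D M x, ← UHat.mk_rep D M y, UHat.dist_mk]
    exact le_of_tendsto' (tendsto_dist D M _ _) fun i => (M i).dist_le_one _ _
  const c := UHat.mk D M fun i => (M i).const c
  func := UHat.func D M
  rel := UHat.rel D M
  func_unif F ε hε x y h := by
    refine dist_func_le D M F ε hε _ _ ?_
    simpa only [UHat.mk_rep] using h
  rel_unif R ε hε x y h := by
    refine abs_rel_sub_le D M R ε hε _ _ ?_
    simpa only [UHat.mk_rep] using h
  abs_rel_le R x := le_of_tendsto' (tendsto_rel D M R _).abs fun i => (M i).abs_rel_le R _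
  μ := ν
  μ_univ_le := by
    rw [hν.2 _ MeasurableSet.univ]
    exact ultraMeasure_univ_le D M

end ContIntLogic

namespace ContIntLogic

/-! ### Countable saturation of set theoretic ultraproducts -/

/-! Two facts carry the proof. The first is countable saturation of the set-theoretic ultraproduct,
`IsCountablyIncomplete.exists_family`: if any finitely many of countably many conditions are jointly
satisfiable at `D`-almost all indices, a single family satisfies each of them almost everywhere. At
each index as many conditions as possible are satisfied, up to a bound that countable incompleteness
keeps finite and that exceeds every number `D`-almost everywhere. The second is Łoś's theorem,
`Formula.tendsto_eval`: the value of a formula in the ultraproduct is the ultralimit of its values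
in the factors.

The integral is the hard case of Łoś's theorem. Countable saturation makes the limit of the measures
countably subadditive on ultraboxes, so the Carathéodory extension has the expected values there
(`ultraMeasure_ultrabox`), and step functions then give that ultralimits commute with integrals
(`tendsto_integral_of_forall_tendsto`). To descend to the metric quotient, where the measure is
prescribed only on the `σ`-algebra of the balls, `τ`-additivity is used: it concentrates the measure
on a separable set whose intersections with open sets lie in that `σ`-algebra, so integrals of
continuous functions are determined (`IsUltraproductMeasure.integral_eq`).

A type over countably many parameters may still contain uncountably many statements, since scalars
are real. Statements with rational scalars are countable in number and approximate all others
uniformly (`Condition.exists_ratCondition`). Łoś's theorem moves the approximating statements to the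
factors, countable saturation solves them there, and Łoś's theorem brings the solution back. -/

theorem IsCountablyIncomplete.exists_family {I : Type v} {D : Ultrafilter I}
    (hD : IsCountablyIncomplete D) {ι : Type x} [Countable ι] {X : I → Type w}
    [∀ i, Nonempty (X i)] (P : ι → ∀ i, X i → Prop)
    (h : ∀ s : Finset ι, ∀ᶠ i in (D : Filter I), ∃ y, ∀ k ∈ s, P k i y) :
    ∃ y : ∀ i, X i, ∀ k, ∀ᶠ i in (D : Filter I), P k i (y i) := by
  classical
  obtain ⟨s, hs, hs'⟩ := hD
  obtain ⟨e, he⟩ := exists_injective_nat ι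
  have hfin : ∀ N, {k | e k < N}.Finite := fun N =>
    Set.Finite.preimage he.injOn (Set.finite_lt_nat N)
  have hcompl : ∀ᶠ i in (D : Filter I), ∃ n, i ∉ s n := by
    filter_upwards [Ultrafilter.compl_mem_iff_notMem.2 hs'] with i hi
    simpa using hi
  -- the number of conditions that can be, and are to be, satisfied at an index
  let Q : I → ℕ → Prop := fun i N =>
    (∀ n < N, i ∈ s n) ∧ ∃ y : X i, ∀ k, e k < N → P k i y
  have hQ : ∀ N, ∀ᶠ i in (D : Filter I), Q i N := fun N => by
    have h1 : ∀ᶠ i in (D : Filter I), ∀ n ∈ Set.Iio N, i ∈ s n :=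
      (eventually_all_finite (Set.finite_Iio N)).2 fun n _ => hs n
    filter_upwards [h1, h (hfin N).toFinset] with i hi hi'
    refine ⟨hi, ?_⟩
    simpa using hi'
  -- The choice at `i` serves every `N` with `Q i N` at once: it belongs to the largest such `N`.
  have hbest : ∀ i, ∃ y : X i, (∃ n, i ∉ s n) → ∀ N, Q i N → ∀ k, e k < N → P k i y := by
    intro i
    by_cases hi : ∃ n, i ∉ s n
    · obtain ⟨n, hn⟩ := hi
      by_cases hex : ∃ N, Q i N
      · obtain ⟨N₀, hN₀⟩ := hex
        -- An index outside `s n` cannot pass the first clause of `Q` beyond `n`, so a largest `N`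
        -- exists.
        have hb : ∀ N, Q i N → N ≤ n := fun N hN => by
          by_contra! hlt
          exact hn (hN.1 n hlt)
        obtain ⟨-, y, hy⟩ := Nat.findGreatest_spec (P := Q i) (hb _ hN₀) hN₀
        exact ⟨y, fun _ N hN k hk => hy k (hk.trans_le (Nat.le_findGreatest (hb _ hN) hN))⟩
      · exact ⟨Classical.arbitrary _, fun _ N hN => (hex ⟨N, hN⟩).elim⟩
    · exact ⟨Classical.arbitrary _, fun h => (hi h).elim⟩
  choose y hy using hbest
  refine ⟨y, fun k => ?_⟩
  -- `Q i N` covers only the conditions numbered strictly below `N`, hence `e k + 1`.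
  filter_upwards [hcompl, hQ (e k + 1)] with i h1 h2
  exact hy i h1 _ h2 k (Nat.lt_succ_self _)

/-! ### The measure of an ultrabox -/

variable {L : MMLanguage.{u}} {I : Type v} (D : Ultrafilter I) (M : I → MMStructure.{u, w} L)

/-- Otherwise points of `A i \ B i`, chosen wherever they exist, form a class in the first ultrabox
and not in the second. This makes the limit of the measures independent of the representing family.
-/
theorem eventually_subset_of_ultrabox_subset {A B : ∀ i, Set (M i).carrier}
    (h : ultrabox D M A ⊆ ultrabox D M B) : ∀ᶠ i in (D : Filter I), A i ⊆ B i := by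
  classical
  by_contra hn
  have hn' : ∀ᶠ i in (D : Filter I), ∃ y, y ∈ A i ∧ y ∉ B i := by
    filter_upwards [Ultrafilter.eventually_not.2 hn] with i hi
    exact Set.not_subset.1 hi
  have hch : ∀ i, ∃ y : (M i).carrier, (∃ y, y ∈ A i ∧ y ∉ B i) → y ∈ A i ∧ y ∉ B i := by
    intro i
    by_cases hi : ∃ y, y ∈ A i ∧ y ∉ B i
    · exact ⟨hi.choose, fun _ => hi.choose_spec⟩
    · exact ⟨Classical.arbitrary _, fun h => (hi h).elim⟩
  choose y hy using hch
  have h1 := (mk_mem_ultrabox D M B y).1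
    (h ((mk_mem_ultrabox D M A y).2 (hn'.mono fun i hi => (hy i hi).1)))
  obtain ⟨i, h2, h3⟩ := (h1.and hn').exists
  exact (hy i h3).2 h2

theorem ulim_mono {f g : I → ℝ≥0∞} (h : f ≤ᶠ[(D : Filter I)] g) : ulim D f ≤ ulim D g :=
  le_of_tendsto_of_tendsto (tendsto_ulim_ennreal D f) (tendsto_ulim_ennreal D g) h

theorem ultraPremeasure_ultrabox {A : ∀ i, Set (M i).carrier} (hA : ∀ i, MeasurableSet (A i)) :
    ultraPremeasure D M (ultrabox D M A) = ulim D fun i => (M i).μ (A i) := by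
  refine le_antisymm (iInf_le_of_le A (iInf_le_of_le hA (iInf_le_of_le rfl le_rfl))) ?_
  refine le_iInf fun B => le_iInf fun _ => le_iInf fun h => ulim_mono D ?_
  filter_upwards [eventually_subset_of_ultrabox_subset D M h.le] with i hi
  exact measure_mono hi

variable {D}

/-- By countable saturation, a cover of an ultrabox by countably many ultraboxes reduces to finitely
many at almost all indices: if it did not, some family would lie in `A` and avoid every `B n`.
Finite subadditivity in the factors then passes to the limit. -/
theorem ulim_measure_le_tsum (hD : IsCountablyIncomplete D) {A : ∀ i, Set (M i).carrier}
    {B : ℕ → ∀ i, Set (M i).carrier} (h : ultrabox D M A ⊆ ⋃ n, ultrabox D M (B n)) :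
    ulim D (fun i => (M i).μ (A i)) ≤ ∑' n, ulim D fun i => (M i).μ (B n i) := by
  have key : ∃ s : Finset ℕ, ∀ᶠ i in (D : Filter I), A i ⊆ ⋃ n ∈ s, B n i := by
    by_contra! hcon
    obtain ⟨y, hy⟩ := hD.exists_family (X := fun i => (M i).carrier)
      (fun n i y => y ∈ A i ∧ y ∉ B n i) (fun s => by
        filter_upwards [hcon s] with i hi
        obtain ⟨y, hy, hy'⟩ := Set.not_subset.1 hi
        refine ⟨y, fun k hk => ⟨hy, fun hk' => hy' ?_⟩⟩
        exact Set.mem_biUnion hk hk')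
    -- The index `0` serves only to extract membership in `A`.
    obtain ⟨n, hn⟩ := Set.mem_iUnion.1
      (h ((mk_mem_ultrabox D M A y).2 ((hy 0).mono fun i hi => hi.1)))
    obtain ⟨i, h1, h2⟩ := (((mk_mem_ultrabox D M (B n) y).1 hn).and (hy n)).exists
    exact h2.2 h1
  obtain ⟨s, hs⟩ := key
  refine le_trans ?_ (ENNReal.sum_le_tsum s)
  refine le_of_tendsto_of_tendsto (tendsto_ulim_ennreal D _)
    (tendsto_finsetSum s fun n _ => tendsto_ulim_ennreal D _) ?_
  filter_upwards [hs] with i hi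
  exact (measure_mono hi).trans (measure_biUnion_finset_le s _)

theorem measurableSet_ultrabox {A : ∀ i, Set (M i).carrier} (hA : ∀ i, MeasurableSet (A i)) :
    MeasurableSet (ultrabox D M A) :=
  MeasurableSpace.measurableSet_generateFrom ⟨A, hA, rfl⟩

/-- The outer measure could only be smaller than the premeasure because of an economical countable
cover. Covers by ultraboxes are excluded by `ulim_measure_le_tsum`, and a cover with any other
member costs `∞`. -/
theorem ultraMeasure_ultrabox (hD : IsCountablyIncomplete D) {A : ∀ i, Set (M i).carrier}
    (hA : ∀ i, MeasurableSet (A i)) :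
    ultraMeasure D M (ultrabox D M A) = ulim D fun i => (M i).μ (A i) := by
  unfold ultraMeasure
  rw [toMeasure_apply _ _ (measurableSet_ultrabox M hA)]
  refine le_antisymm ((OuterMeasure.ofFunction_le _).trans_eq (ultraPremeasure_ultrabox D M hA)) ?_
  rw [OuterMeasure.ofFunction_apply]
  refine le_iInf fun S => le_iInf fun hS => ?_
  by_cases hbox : ∀ n, ∃ B : ∀ i, Set (M i).carrier, (∀ i, MeasurableSet (B i)) ∧
      S n = ultrabox D M B
  · choose B hB hSB using hbox
    obtain rfl : S = fun n => ultrabox D M (B n) := funext hSB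
    refine (ulim_measure_le_tsum M hD hS).trans_eq ?_
    exact tsum_congr fun n => (ultraPremeasure_ultrabox D M (hB n)).symm
  · push Not at hbox
    obtain ⟨n, hn⟩ := hbox
    have : ultraPremeasure D M (S n) = ⊤ :=
      iInf_eq_top.2 fun B => iInf_eq_top.2 fun hB => iInf_eq_top.2 fun h => (hn B hB h).elim
    exact le_top.trans (this.symm.le.trans (ENNReal.le_tsum n))

instance MMStructure.isFiniteMeasure (N : MMStructure.{u, w} L) : IsFiniteMeasure N.μ :=
  ⟨N.μ_univ_le.trans_lt ENNReal.one_lt_top⟩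

theorem MMStructure.measureReal_univ_le (N : MMStructure.{u, w} L) : N.μ.real Set.univ ≤ 1 :=
  ENNReal.toReal_le_of_le_ofReal zero_le_one (by simpa using N.μ_univ_le)

instance ultraMeasure.isFiniteMeasure : IsFiniteMeasure (ultraMeasure D M) :=
  ⟨(ultraMeasure_univ_le D M).trans_lt ENNReal.one_lt_top⟩

theorem ultraMeasure_real_univ_le : (ultraMeasure D M).real Set.univ ≤ 1 :=
  ENNReal.toReal_le_of_le_ofReal zero_le_one (by simpa using ultraMeasure_univ_le D M)

theorem tendsto_measureReal_ultrabox (hD : IsCountablyIncomplete D)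
    {A : ∀ i, Set (M i).carrier} (hA : ∀ i, MeasurableSet (A i)) :
    Tendsto (fun i => (M i).μ.real (A i)) D
      (𝓝 ((ultraMeasure D M).real (ultrabox D M A))) := by
  refine (ENNReal.tendsto_toReal (measure_ne_top _ _)).comp ?_
  rw [ultraMeasure_ultrabox M hD hA]
  exact tendsto_ulim_ennreal D _

/-! ### Integrals of limits of functions -/

/-- The sum `∑ k * ε * c k` over the integers `k` with `|k| ≤ m`; for `c` the indicator of
`⌊t / ε⌋` this is the approximation `⌊t / ε⌋ * ε` of `t`. -/
noncomputable def stepSum (ε : ℝ) (m : ℕ) (c : ℤ → ℝ) : ℝ :=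
  ∑ k ∈ Finset.Icc (-m : ℤ) m, k * ε * c k

theorem abs_stepSum_sub_le {ε C t : ℝ} {m : ℕ} (hε : 0 < ε) (hm : C / ε + 1 ≤ m) (ht : |t| ≤ C) :
    |stepSum ε m (fun k => if ⌊t / ε⌋ = k then 1 else 0) - t| ≤ ε := by
  -- The floor may fall up to one below `-C / ε`, which is why `hm` has the summand `1`.
  have hmem : ⌊t / ε⌋ ∈ Finset.Icc (-m : ℤ) m := by
    have h1 : |t / ε| ≤ C / ε := by
      rw [abs_div, abs_of_pos hε]; gcongr
    have h2 := abs_le.1 h1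
    have h3 := Int.floor_le (t / ε)
    have h4 := Int.lt_floor_add_one (t / ε)
    rw [Finset.mem_Icc]
    constructor
    · have : (-m : ℝ) ≤ ⌊t / ε⌋ := by linarith
      exact_mod_cast this
    · have : (⌊t / ε⌋ : ℝ) ≤ m := by linarith
      exact_mod_cast this
  have : stepSum ε m (fun k => if ⌊t / ε⌋ = k then 1 else 0) = ⌊t / ε⌋ * ε := by
    unfold stepSum
    simp only [mul_ite, mul_one, mul_zero]
    rw [Finset.sum_ite_eq, if_pos hmem]
  rw [this, abs_le]
  have h3 := (le_div_iff₀ hε).1 (Int.floor_le (t / ε))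
  have h4 := (div_lt_iff₀ hε).1 (Int.lt_floor_add_one (t / ε))
  constructor <;> linarith

theorem integral_stepSum {X : Type x} [MeasurableSpace X] (μ : Measure X) [IsFiniteMeasure μ]
    (ε : ℝ) (m : ℕ) {S : ℤ → Set X} (hS : ∀ k, MeasurableSet (S k)) :
    ∫ y, stepSum ε m (fun k => (S k).indicator 1 y) ∂μ = stepSum ε m fun k => μ.real (S k) := by
  unfold stepSum
  rw [integral_finsetSum]
  · refine Finset.sum_congr rfl fun k _ => ?_
    rw [integral_const_mul, integral_indicator_one (hS k)]
  · exact fun k _ => ((integrable_const (1 : ℝ)).indicator (hS k)).const_mul _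

theorem measurable_stepSum {X : Type x} [MeasurableSpace X]
    (ε : ℝ) (m : ℕ) {S : ℤ → Set X} (hS : ∀ k, MeasurableSet (S k)) :
    Measurable fun y => stepSum ε m (fun k => (S k).indicator 1 y) :=
  Finset.measurable_fun_sum _ fun k _ => (measurable_one.indicator (hS k)).const_mul _

theorem integrable_of_abs_le {X : Type x} [MeasurableSpace X] {μ : Measure X} [IsFiniteMeasure μ]
    {f : X → ℝ} (hf : Measurable f) {C : ℝ} (hC : ∀ y, |f y| ≤ C) : Integrable f μ :=
  .of_bound hf.aestronglyMeasurable C (ae_of_all _ hC)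

theorem abs_integral_sub_le {X : Type x} [MeasurableSpace X] {μ : Measure X} [IsFiniteMeasure μ]
    (hμ : μ.real Set.univ ≤ 1) {f g : X → ℝ} (hf : Integrable f μ) (hg : Integrable g μ) {ε : ℝ}
    (hε : 0 ≤ ε) (h : ∀ y, |f y - g y| ≤ ε) : |∫ y, f y ∂μ - ∫ y, g y ∂μ| ≤ ε := by
  rw [← integral_sub hf hg]
  refine (norm_integral_le_of_norm_le_const (C := ε)
    (ae_of_all _ fun y => (Real.norm_eq_abs _).trans_le (h y))).trans ?_
  exact mul_le_of_le_one_right hε hμ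

theorem eventually_stepSum_indicator_eq (ε : ℝ) (m : ℕ) (S : ℤ → ∀ i, Set (M i).carrier)
    (a : ∀ i, (M i).carrier) : ∀ᶠ i in (D : Filter I),
      stepSum ε m (fun k => (S k i).indicator 1 (a i)) =
        stepSum ε m (fun k => (ultrabox D M (S k)).indicator 1 (UProd.mk D M a)) := by
  have : ∀ k ∈ Finset.Icc (-m : ℤ) m, ∀ᶠ i in (D : Filter I),
      (S k i).indicator (1 : (M i).carrier → ℝ) (a i) =
        (ultrabox D M (S k)).indicator (1 : UProd D M → ℝ) (UProd.mk D M a) := by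
    intro k _
    by_cases hk : UProd.mk D M a ∈ ultrabox D M (S k)
    · filter_upwards [(mk_mem_ultrabox D M _ a).1 hk] with i hi
      rw [Set.indicator_of_mem hk, Set.indicator_of_mem hi, Pi.one_apply, Pi.one_apply]
    · have hk' := hk
      rw [mk_mem_ultrabox, ← Ultrafilter.eventually_not] at hk'
      filter_upwards [hk'] with i hi
      rw [Set.indicator_of_notMem hi, Set.indicator_of_notMem hk]
  filter_upwards [(Filter.eventually_all_finset _).2 this] with i hi
  exact Finset.sum_congr rfl fun k hk => congrArg (k * ε * ·) (hi k hk)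

/-- Both step functions come from the level sets of `⌊f i / ε⌋`, the second through the ultraboxes
of these sets. Those need not be level sets of `⌊F / ε⌋`, but the error bound passes to the limit.
The uniform bound `C` leaves finitely many levels, so the integrals converge by convergence of
measures of ultraboxes. -/
theorem exists_step_approx (hD : IsCountablyIncomplete D)
    {f : ∀ i, (M i).carrier → ℝ} (hf : ∀ i, Measurable (f i)) {C : ℝ} (hC : ∀ i y, |f i y| ≤ C)
    {F : UProd D M → ℝ}
    (hF : ∀ a : ∀ i, (M i).carrier,
      Tendsto (fun i => f i (a i)) D (𝓝 (F (UProd.mk D M a)))) {ε : ℝ} (hε : 0 < ε) :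
    ∃ (g : ∀ i, (M i).carrier → ℝ) (G : UProd D M → ℝ), (∀ i, Measurable (g i)) ∧ Measurable G ∧
      (∀ i y, |g i y - f i y| ≤ ε) ∧ (∀ z, |G z - F z| ≤ ε) ∧
      Tendsto (fun i => ∫ y, g i y ∂(M i).μ) D (𝓝 (∫ z, G z ∂ultraMeasure D M)) := by
  classical
  obtain ⟨m, hm⟩ := exists_nat_ge (C / ε + 1)
  obtain ⟨S, hS, hSf⟩ : ∃ S : ℤ → ∀ i, Set (M i).carrier, (∀ k i, MeasurableSet (S k i)) ∧
      ∀ k i y, (S k i).indicator (1 : (M i).carrier → ℝ) y = if ⌊f i y / ε⌋ = k then 1 else 0 :=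
    ⟨fun k i => {y | ⌊f i y / ε⌋ = k},
      fun k i => ((hf i).div_const ε).floor (measurableSet_singleton k),
      fun k i y => by simp [Set.indicator_apply]⟩
  have hg : ∀ i y, |stepSum ε m (fun k => (S k i).indicator 1 y) - f i y| ≤ ε := by
    intro i y
    simp only [hSf]
    exact abs_stepSum_sub_le hε hm (hC i y)
  refine ⟨fun i y => stepSum ε m (fun k => (S k i).indicator 1 y),
    fun z => stepSum ε m (fun k => (ultrabox D M (S k)).indicator 1 z),
    fun i => measurable_stepSum _ _ fun k => hS k i,
    measurable_stepSum _ _ fun k => measurableSet_ultrabox M (hS k), hg, fun z => ?_, ?_⟩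
  · obtain ⟨a, rfl⟩ := UProd.mk_surjective D M z
    refine le_of_tendsto ((tendsto_const_nhds.sub (hF a)).abs) ?_
    filter_upwards [eventually_stepSum_indicator_eq M ε m S a] with i hi
    rw [← hi]
    exact hg i _
  · rw [integral_stepSum _ _ _ fun k => measurableSet_ultrabox M (hS k),
      funext fun i => integral_stepSum (M i).μ ε m fun k => hS k i]
    exact tendsto_finsetSum _ fun k _ => (tendsto_measureReal_ultrabox M hD (hS k)).const_mul _

theorem integrable_of_abs_sub_le {X : Type x} [MeasurableSpace X] {μ : Measure X}
    [IsFiniteMeasure μ] {f g : X → ℝ} (hg : Measurable g) {C ε : ℝ} (hC : ∀ y, |f y| ≤ C)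
    (h : ∀ y, |g y - f y| ≤ ε) : Integrable g μ :=
  integrable_of_abs_le hg (C := C + ε) fun y => by
    have := abs_sub_abs_le_abs_sub (g y) (f y)
    linarith [h y, hC y]

theorem abs_le_of_forall_tendsto {f : ∀ i, (M i).carrier → ℝ} {C : ℝ} (hC : ∀ i y, |f i y| ≤ C)
    {F : UProd D M → ℝ}
    (hF : ∀ a : ∀ i, (M i).carrier,
      Tendsto (fun i => f i (a i)) D (𝓝 (F (UProd.mk D M a)))) (z : UProd D M) : |F z| ≤ C := by
  obtain ⟨a, rfl⟩ := UProd.mk_surjective D M z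
  exact le_of_tendsto' (hF a).abs fun i => hC i _

theorem measurable_of_forall_tendsto (hD : IsCountablyIncomplete D)
    {f : ∀ i, (M i).carrier → ℝ} (hf : ∀ i, Measurable (f i)) {C : ℝ} (hC : ∀ i y, |f i y| ≤ C)
    {F : UProd D M → ℝ}
    (hF : ∀ a : ∀ i, (M i).carrier,
      Tendsto (fun i => f i (a i)) D (𝓝 (F (UProd.mk D M a)))) : Measurable F := by
  choose g G _ hG _ hGF _ using
    fun n : ℕ => exists_step_approx M hD hf hC hF (ε := 1 / ((n : ℝ) + 1)) Nat.one_div_pos_of_nat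
  refine measurable_of_tendsto_metrizable hG (tendsto_pi_nhds.2 fun z => ?_)
  rw [tendsto_iff_dist_tendsto_zero]
  exact squeeze_zero (fun _ => dist_nonneg) (fun n => hGF n z)
    tendsto_one_div_add_atTop_nhds_zero_nat

theorem tendsto_integral_of_forall_tendsto (hD : IsCountablyIncomplete D)
    {f : ∀ i, (M i).carrier → ℝ} (hf : ∀ i, Measurable (f i)) {C : ℝ} (hC : ∀ i y, |f i y| ≤ C)
    {F : UProd D M → ℝ}
    (hF : ∀ a : ∀ i, (M i).carrier,
      Tendsto (fun i => f i (a i)) D (𝓝 (F (UProd.mk D M a)))) :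
    Tendsto (fun i => ∫ y, f i y ∂(M i).μ) D (𝓝 (∫ z, F z ∂ultraMeasure D M)) := by
  have hFC := abs_le_of_forall_tendsto M hC hF
  refine Metric.tendsto_nhds.2 fun ε hε => ?_
  -- Three errors of size `ε / 4` arise: one approximation on each side and the convergence of the
  -- step integrals.
  have hδ : 0 < ε / 4 := by positivity
  obtain ⟨g, G, hg, hG, hgf, hGF, hlim⟩ := exists_step_approx M hD hf hC hF hδ
  filter_upwards [Metric.tendsto_nhds.1 hlim (ε / 4) hδ] with i hi
  have h1 := abs_integral_sub_le (M i).measureReal_univ_le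
    (integrable_of_abs_sub_le (hg i) (hC i) (hgf i)) (integrable_of_abs_le (hf i) (hC i)) hδ.le
    (hgf i)
  have h2 := abs_integral_sub_le (ultraMeasure_real_univ_le M)
    (integrable_of_abs_sub_le hG hFC hGF)
    (integrable_of_abs_le (measurable_of_forall_tendsto M hD hf hC hF) hFC) hδ.le hGF
  rw [Real.dist_eq, abs_lt] at hi
  rw [abs_le] at h1 h2
  rw [Real.dist_eq, abs_lt]
  constructor <;> linarith

end ContIntLogic

namespace ContIntLogic

/-! ### Continuity and boundedness of formulas -/

section Formulas

variable {L : MMLanguage.{u}} (M : MMStructure.{u, w} L) {α : Type v}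

theorem Term.uniformContinuous_eval (t : Term L α) :
    UniformContinuous fun a : α → M.carrier => t.eval M a := by
  induction t with
  | var y => exact Pi.uniformContinuous_proj _ y
  | const c => exact uniformContinuous_const
  | func F ts ih =>
    have hF : UniformContinuous (M.func F) := Metric.uniformContinuous_iff.2 fun ε hε =>
      ⟨_, L.funcMod_pos F (ε / 2) (half_pos hε), fun {a b} h =>
        (M.func_unif F _ (half_pos hε) a b h).trans_lt (half_lt_self hε)⟩
    exact hF.comp (uniformContinuous_pi.2 ih)

theorem MMStructure.uniformContinuous_rel (R : L.Rel) : UniformContinuous (M.rel R) :=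
  Metric.uniformContinuous_iff.2 fun ε hε =>
    ⟨_, L.relMod_pos R (ε / 2) (half_pos hε), fun {a b} h =>
      (M.rel_unif R _ (half_pos hε) a b h).trans_lt (half_lt_self hε)⟩

theorem abs_ciSup_sub_ciSup_le {Y : Type x} [Nonempty Y] {f g : Y → ℝ}
    (hf : BddAbove (Set.range f)) (hg : BddAbove (Set.range g)) {ε : ℝ}
    (h : ∀ y, |f y - g y| ≤ ε) : |(⨆ y, f y) - ⨆ y, g y| ≤ ε := by
  rw [abs_le]
  constructor
  · have : (⨆ y, g y) ≤ (⨆ y, f y) + ε := ciSup_le fun y => by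
      linarith [(abs_le.1 (h y)).1, le_ciSup hf y]
    linarith
  · have : (⨆ y, f y) ≤ (⨆ y, g y) + ε := ciSup_le fun y => by
      linarith [(abs_le.1 (h y)).2, le_ciSup hg y]
    linarith

theorem bddAbove_range_of_abs_le {Y : Type x} {f : Y → ℝ} {C : ℝ} (h : ∀ y, |f y| ≤ C) :
    BddAbove (Set.range f) :=
  ⟨C, Set.forall_mem_range.2 fun y => (abs_le.1 (h y)).2⟩

/-- The bound is independent of the structure, so it holds for all factors simultaneously. -/
theorem Formula.exists_abs_eval_le {k : ℕ} (φ : Formula L α k) :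
    ∃ C : ℝ, 0 ≤ C ∧ ∀ (M : MMStructure.{u, w} L) (a : α → M.carrier) (b : Fin k → M.carrier),
      |φ.eval M a b| ≤ C := by
  induction φ with
  | one => exact ⟨1, zero_le_one, fun M a b => by simp [Formula.eval]⟩
  | rho s t =>
    exact ⟨1, zero_le_one, fun M a b => by
      simpa [Formula.eval] using M.dist_le_one _ _⟩
  | rel R ts => exact ⟨_, L.relBound_nonneg R, fun M a b => M.abs_rel_le R _⟩
  | smul r φ ih =>
    obtain ⟨C, hC, h⟩ := ih
    refine ⟨|r| * C, by positivity, fun M a b => ?_⟩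
    simp only [Formula.eval, abs_mul]
    exact mul_le_mul_of_nonneg_left (h M a b) (abs_nonneg r)
  | add φ ψ ih1 ih2 =>
    obtain ⟨C, hC, h⟩ := ih1
    obtain ⟨C', hC', h'⟩ := ih2
    exact ⟨C + C', by positivity, fun M a b =>
      (abs_add_le _ _).trans (add_le_add (h M a b) (h' M a b))⟩
  | min φ ψ ih1 ih2 =>
    obtain ⟨C, hC, h⟩ := ih1
    obtain ⟨C', hC', h'⟩ := ih2
    exact ⟨max C C', le_max_of_le_left hC, fun M a b =>
      abs_min_le_max_abs_abs.trans (max_le_max (h M a b) (h' M a b))⟩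
  | sup φ ih =>
    obtain ⟨C, hC, h⟩ := ih
    refine ⟨C, hC, fun M a b => abs_le.2 ⟨?_, ciSup_le fun y => (abs_le.1 (h M a _)).2⟩⟩
    exact le_ciSup_of_le (bddAbove_range_of_abs_le fun y => h M a (Fin.snoc b y))
      (Classical.arbitrary _) (abs_le.1 (h M a _)).1
  | integral φ ih =>
    obtain ⟨C, hC, h⟩ := ih
    refine ⟨C, hC, fun M a b => ?_⟩
    refine (norm_integral_le_of_norm_le_const (C := C)
      (ae_of_all _ fun y => (Real.norm_eq_abs _).trans_le (h M a (Fin.snoc b y)))).trans ?_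
    exact mul_le_of_le_one_right hC M.measureReal_univ_le

theorem uniformContinuous_snoc {X : Type w} [UniformSpace X] {k : ℕ} :
    UniformContinuous fun p : (Fin k → X) × X => (Fin.snoc p.1 p.2 : Fin (k + 1) → X) := by
  refine uniformContinuous_pi.2 fun j => ?_
  refine Fin.lastCases ?_ (fun j => ?_) j
  · simpa using uniformContinuous_snd
  · simpa using! (Pi.uniformContinuous_proj (fun _ => X) j).comp uniformContinuous_fst

/-- Pairing `y` with itself lies in every entourage, so joint uniform continuity gives a modulus in
the first variable that is uniform in `y`. This is what lets `sup` and the integral preserve uniform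
continuity. -/
theorem eventually_uniformity_forall_abs_sub_le {X : Type v} {Y : Type w} [UniformSpace X]
    [UniformSpace Y] {f : X × Y → ℝ} (hf : UniformContinuous f) {ε : ℝ} (hε : 0 < ε) :
    ∀ᶠ p in uniformity X, ∀ y, |f (p.1, y) - f (p.2, y)| ≤ ε := by
  obtain ⟨s, hs, t, ht, h⟩ := entourageProd_subset (mem_map.1 (hf (Metric.dist_mem_uniformity hε)))
  filter_upwards [hs] with p hp y
  have : ((p.1, y), (p.2, y)) ∈ entourageProd s t := ⟨hp, refl_mem_uniformity ht⟩
  exact (Real.dist_eq _ _).symm.trans_le (le_of_lt (h this))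

theorem uniformContinuous_of_abs_sub_le {X : Type v} [UniformSpace X] {f : X → ℝ}
    (h : ∀ ε, 0 < ε → ∀ᶠ p in uniformity X, |f p.1 - f p.2| ≤ ε) : UniformContinuous f :=
  Metric.uniformity_basis_dist_le.tendsto_right_iff.2 h

theorem Formula.integrable_of_uniformContinuous {k : ℕ} {φ : Formula L α (k + 1)}
    (h : UniformContinuous
      fun p : ((α → M.carrier) × (Fin k → M.carrier)) × M.carrier =>
        φ.eval M p.1.1 (Fin.snoc p.1.2 p.2)) (a : α → M.carrier) (b : Fin k → M.carrier) :
    Integrable (fun y => φ.eval M a (Fin.snoc b y)) M.μ := by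
  obtain ⟨C, -, hC⟩ := φ.exists_abs_eval_le
  have : Continuous fun y => φ.eval M a (Fin.snoc b y) :=
    h.continuous.comp (Continuous.prodMk_right (a, b))
  exact integrable_of_abs_le this.measurable fun y => hC M _ _

/-- Uniform continuity, jointly in all variables, is what survives the quantifiers; mere continuity
is not preserved by `sup`. The resulting continuity provides measurability and integrability of the
integrands. -/
theorem Formula.uniformContinuous_eval {k : ℕ} (φ : Formula L α k) :
    UniformContinuous fun p : (α → M.carrier) × (Fin k → M.carrier) => φ.eval M p.1 p.2 := by
  have hterm : ∀ {k : ℕ} (t : Term L (α ⊕ Fin k)), UniformContinuous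
      fun p : (α → M.carrier) × (Fin k → M.carrier) => t.eval M (Sum.elim p.1 p.2) := by
    intro k t
    refine (t.uniformContinuous_eval M).comp (uniformContinuous_pi.2 ?_)
    rintro (y | j)
    · exact (Pi.uniformContinuous_proj _ y).comp uniformContinuous_fst
    · exact (Pi.uniformContinuous_proj _ j).comp uniformContinuous_snd
  have hsnoc : ∀ {k : ℕ} {φ : Formula L α (k + 1)}, (UniformContinuous
      fun p : (α → M.carrier) × (Fin (k + 1) → M.carrier) => φ.eval M p.1 p.2) →
      UniformContinuous fun p : ((α → M.carrier) × (Fin k → M.carrier)) × M.carrier =>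
        φ.eval M p.1.1 (Fin.snoc p.1.2 p.2) := by
    intro k φ h
    exact h.comp ((uniformContinuous_fst.comp uniformContinuous_fst).prodMk
      (uniformContinuous_snoc.comp
        ((uniformContinuous_snd.comp uniformContinuous_fst).prodMk uniformContinuous_snd)))
  induction φ with
  | one => exact uniformContinuous_const
  | rho s t => exact (hterm s).dist (hterm t)
  | rel R ts => exact (M.uniformContinuous_rel R).comp (uniformContinuous_pi.2 fun j => hterm _)
  | smul r φ ih => exact ih.const_mul' r
  | add φ ψ ih1 ih2 => exact ih1.add ih2
  | min φ ψ ih1 ih2 =>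
    refine uniformContinuous_of_abs_sub_le fun ε hε => ?_
    filter_upwards [ih1 (Metric.dist_mem_uniformity hε), ih2 (Metric.dist_mem_uniformity hε)]
      with p h1 h2
    exact (abs_min_sub_min_le_max _ _ _ _).trans (max_le (le_of_lt h1) (le_of_lt h2))
  | sup φ ih =>
    obtain ⟨C, -, hC⟩ := φ.exists_abs_eval_le
    refine uniformContinuous_of_abs_sub_le fun ε hε => ?_
    filter_upwards [eventually_uniformity_forall_abs_sub_le (hsnoc ih) hε] with p hp
    exact abs_ciSup_sub_ciSup_le (bddAbove_range_of_abs_le fun y => hC M _ _)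
      (bddAbove_range_of_abs_le fun y => hC M _ _) hp
  | integral φ ih =>
    refine uniformContinuous_of_abs_sub_le fun ε hε => ?_
    filter_upwards [eventually_uniformity_forall_abs_sub_le (hsnoc ih) hε] with p hp
    exact abs_integral_sub_le M.measureReal_univ_le
      (Formula.integrable_of_uniformContinuous M (hsnoc ih) _ _)
      (Formula.integrable_of_uniformContinuous M (hsnoc ih) _ _) hε.le hp

theorem Formula.continuous_eval_snoc {k : ℕ} (φ : Formula L α (k + 1))
    (a : α → M.carrier) (b : Fin k → M.carrier) :
    Continuous fun y => φ.eval M a (Fin.snoc b y) :=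
  (φ.uniformContinuous_eval M).continuous.comp
    (continuous_const.prodMk
      (uniformContinuous_snoc.continuous.comp (Continuous.prodMk_right b)))

theorem Formula.integrable_eval_snoc {k : ℕ} (φ : Formula L α (k + 1))
    (a : α → M.carrier) (b : Fin k → M.carrier) :
    Integrable (fun y => φ.eval M a (Fin.snoc b y)) M.μ := by
  obtain ⟨C, -, hC⟩ := φ.exists_abs_eval_le
  exact integrable_of_abs_le (φ.continuous_eval_snoc M a b).measurable fun y => hC M _ _

end Formulas

end ContIntLogic

namespace ContIntLogic

/-! ### `τ`-additive measures on metric spaces -/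

/-- The `σ`-algebra generated by the open balls. -/
abbrev ballMeasurableSpace (X : Type x) [MetricSpace X] : MeasurableSpace X :=
  MeasurableSpace.generateFrom {B : Set X | ∃ c r, B = Metric.ball c r}

section TauAdditive

variable {X : Type x} [MetricSpace X] [MeasurableSpace X] {ν : Measure X}

theorem IsTauAdditive.exists_countable_biUnion_ball (hν : IsTauAdditive ν)
    {ε : ℝ} (hε : 0 < ε) :
    ∃ C : Set X, C.Countable ∧ ν (⋃ c ∈ C, Metric.ball c ε) = ν Set.univ := by
  classical
  -- Finite unions of balls form a directed open cover, so `τ`-additivity makes the total mass the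
  -- supremum of their measures; a sequence approaching it uses countably many centres.
  let B : Finset X → Set X := fun s => ⋃ c ∈ s, Metric.ball c ε
  have hsup : ν Set.univ = sSup (Set.range fun s => ν (B s)) := by
    have huniv : ⋃₀ Set.range B = Set.univ := Set.eq_univ_of_forall fun y =>
      Set.mem_sUnion.2 ⟨B {y}, ⟨{y}, rfl⟩, by simp [B, hε]⟩
    have := hν (Set.range B)
      (Set.forall_mem_range.2 fun s => isOpen_biUnion fun c _ => Metric.isOpen_ball) (by
        rintro _ ⟨s, rfl⟩ _ ⟨t, rfl⟩
        exact ⟨_, ⟨s ∪ t, rfl⟩,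
          Set.biUnion_subset_biUnion_left fun c hc => Finset.mem_union_left t hc,
          Set.biUnion_subset_biUnion_left fun c hc => Finset.mem_union_right s hc⟩)
    rw [huniv, iSup_range] at this
    exact this
  obtain ⟨u, -, hu, hmem⟩ := exists_seq_tendsto_sSup
    (Set.range_nonempty fun s => ν (B s)) (OrderTop.bddAbove _)
  choose s hs using hmem
  refine ⟨⋃ n, (s n : Set X), Set.countable_iUnion fun n => (s n).countable_toSet,
    le_antisymm (measure_mono (Set.subset_univ _)) ?_⟩
  rw [hsup]
  refine le_of_tendsto' hu fun n => ?_
  rw [← hs n]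
  exact measure_mono (Set.biUnion_subset_biUnion_left fun c hc => Set.mem_iUnion.2 ⟨n, hc⟩)

/-- The set `S` consists of the points that lie within `1 / (n + 1)` of a fixed countable set for
every `n`; it is separable and of full measure. On it, an open set is a countable union of those
small balls around the countable set that it contains. -/
theorem IsTauAdditive.exists_measurableSet_inter [BorelSpace X] [IsFiniteMeasure ν]
    (hν : IsTauAdditive ν) :
    ∃ S : Set X, ν Sᶜ = 0 ∧ ∀ U : Set X, IsOpen U → MeasurableSet[ballMeasurableSpace X] (U ∩ S) := by
  have hpos : ∀ n : ℕ, 0 < 1 / ((n : ℝ) + 1) := fun n => Nat.one_div_pos_of_nat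
  choose C hC hCν using fun n => hν.exists_countable_biUnion_ball (hpos n)
  let C' : Set X := ⋃ n, C n
  have hC' : C'.Countable := Set.countable_iUnion hC
  have hball : ∀ c r, MeasurableSet[ballMeasurableSpace X] (Metric.ball c r) := fun c r =>
    MeasurableSpace.measurableSet_generateFrom ⟨c, r, rfl⟩
  let W : ℕ → Set X := fun n => ⋃ c ∈ C', Metric.ball c (1 / ((n : ℝ) + 1))
  refine ⟨⋂ n, W n, ?_, fun U hU => ?_⟩
  · rw [Set.compl_iInter, measure_iUnion_null_iff]
    intro n
    have hW : MeasurableSet (W n) := (isOpen_biUnion fun c _ => Metric.isOpen_ball).measurableSet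
    rw [measure_compl hW (measure_ne_top _ _), tsub_eq_zero_iff_le, ← hCν n]
    exact measure_mono (Set.biUnion_subset_biUnion_left fun c hc => Set.mem_iUnion.2 ⟨n, hc⟩)
  · have hUS : U ∩ ⋂ n, W n = (⋃ n : ℕ, ⋃ c ∈ {c ∈ C' | Metric.ball c (1 / ((n : ℝ) + 1)) ⊆ U},
        Metric.ball c (1 / ((n : ℝ) + 1))) ∩ ⋂ n, W n := by
      ext y
      simp only [Set.mem_inter_iff, and_congr_left_iff]
      intro hy
      constructor
      · intro hyU
        obtain ⟨r, hr, hrU⟩ := Metric.isOpen_iff.1 hU y hyU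
        -- A ball of radius below `r / 2` that contains `y` lies inside the ball of radius `r` about
        -- `y`.
        obtain ⟨n, hn⟩ := exists_nat_one_div_lt (half_pos hr)
        obtain ⟨c, hc, hyc⟩ := Set.mem_iUnion₂.1 (Set.mem_iInter.1 hy n)
        refine Set.mem_iUnion.2 ⟨n, Set.mem_iUnion₂.2 ⟨c, ⟨hc, fun z hz => hrU ?_⟩, hyc⟩⟩
        rw [Metric.mem_ball] at hz hyc ⊢
        have := dist_triangle_right z y c
        linarith
      · intro h
        obtain ⟨n, h⟩ := Set.mem_iUnion.1 h
        obtain ⟨c, hc, hyc⟩ := Set.mem_iUnion₂.1 h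
        exact hc.2 hyc
    rw [hUS]
    refine MeasurableSet.inter ?_ ?_
    · exact MeasurableSet.iUnion fun n => MeasurableSet.biUnion (hC'.mono (Set.sep_subset _ _))
        fun c _ => hball _ _
    · exact MeasurableSet.iInter fun n => MeasurableSet.biUnion hC' fun c _ => hball _ _

end TauAdditive

/-! ### Integration of continuous functions over the ultraproduct -/

variable {L : MMLanguage.{u}} {I : Type v} {D : Ultrafilter I} (M : I → MMStructure.{u, w} L)

/-- The distance to a point of the quotient is an ultralimit of distance functions in the factors,
hence measurable. -/
theorem UHat.measurable_proj (hD : IsCountablyIncomplete D) :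
    @Measurable _ _ _ (ballMeasurableSpace (UHat D M)) (UHat.proj D M) := by
  refine measurable_generateFrom ?_
  rintro _ ⟨c, r, rfl⟩
  obtain ⟨c, rfl⟩ := UHat.mk_surjective D M c
  have : Measurable fun z => dist (UHat.proj D M z) (UHat.mk D M c) :=
    measurable_of_forall_tendsto M hD (f := fun i y => dist y (c i))
      (fun i => (continuous_id.dist continuous_const).measurable) (C := 1)
      (fun i y => by simpa using (M i).dist_le_one y (c i)) fun a => tendsto_dist D M a c
  exact this measurableSet_Iio

variable {M} in
-- A continuous `f` need not be measurable for the `σ`-algebra of the balls, but its restriction to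
-- the set `S` of full measure is, and on that `σ`-algebra `ν` is the push-forward of the measure
-- upstairs.
theorem IsUltraproductMeasure.integral_eq (hD : IsCountablyIncomplete D)
    {ν : Measure (UHat D M)} (hν : IsUltraproductMeasure D M ν) {f : UHat D M → ℝ}
    (hf : Continuous f) :
    ∫ y, f y ∂ν = ∫ z, f (UHat.proj D M z) ∂ultraMeasure D M := by
  have : IsFiniteMeasure ν := ⟨by
    rw [hν.2 _ MeasurableSet.univ]
    exact (ultraMeasure_univ_le D M).trans_lt ENNReal.one_lt_top⟩
  obtain ⟨S, hS, hSU⟩ := hν.1.exists_measurableSet_inter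
  have hproj := UHat.measurable_proj M hD
  have hνB : ∀ B, MeasurableSet[ballMeasurableSpace (UHat D M)] B →
      ν B = ultraMeasure D M (UHat.proj D M ⁻¹' B) := hν.2
  have hle : ballMeasurableSpace (UHat D M) ≤ UHat.instMeasurableSpace D M := by
    refine MeasurableSpace.generateFrom_le ?_
    rintro _ ⟨c, r, rfl⟩
    exact Metric.isOpen_ball.measurableSet
  have hSm : MeasurableSet[ballMeasurableSpace (UHat D M)] S := by simpa using hSU _ isOpen_univ
  have hg : Measurable[ballMeasurableSpace (UHat D M)] (S.indicator f) := by
    refine @measurable_of_isOpen _ _ _ _ _ (ballMeasurableSpace (UHat D M)) _ fun V hV => ?_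
    rw [Set.indicator_preimage, Set.ite]
    refine (hSU _ (hV.preimage hf)).union ?_
    exact (MeasurableSet.diff (measurable_const (a := (0 : ℝ)) hV.measurableSet) hSm)
  have htrim : ν.trim hle =
      @Measure.map _ _ _ (ballMeasurableSpace (UHat D M)) (UHat.proj D M) (ultraMeasure D M) := by
    refine @Measure.ext _ (ballMeasurableSpace (UHat D M)) _ _ fun B hB => ?_
    rw [trim_measurableSet_eq hle hB,
      @Measure.map_apply _ _ _ (ballMeasurableSpace (UHat D M)) _ _ hproj _ hB, hνB B hB]
  calc ∫ y, f y ∂ν = ∫ y, S.indicator f y ∂ν := by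
        refine integral_congr_ae ?_
        filter_upwards [compl_mem_ae_iff.2 hS] with y hy
        rw [Set.indicator_of_mem (by simpa using hy)]
    _ = ∫ y, S.indicator f y ∂ν.trim hle := integral_trim hle hg.stronglyMeasurable
    _ = ∫ z, S.indicator f (UHat.proj D M z) ∂ultraMeasure D M := by
        rw [htrim]
        exact @integral_map _ _ _ _ _ _ _ (ballMeasurableSpace (UHat D M)) _
          (@Measurable.aemeasurable _ _ _ (ballMeasurableSpace (UHat D M)) _ _ hproj) _
          hg.stronglyMeasurable.aestronglyMeasurable
    _ = ∫ z, f (UHat.proj D M z) ∂ultraMeasure D M := by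
        refine integral_congr_ae ?_
        have h0 : ultraMeasure D M (UHat.proj D M ⁻¹' Sᶜ) = 0 := by
          rw [← hνB _ hSm.compl, hS]
        filter_upwards [compl_mem_ae_iff.2 h0] with y hy
        rw [Set.indicator_of_mem (by simpa using hy)]

/-! ### Łoś's theorem -/

variable {M} {ν : Measure (UHat D M)} (hν : IsUltraproductMeasure D M ν)

theorem Term.eval_ultraproduct {α : Type x} (t : Term L α) (a : α → ∀ i, (M i).carrier) :
    t.eval (ultraproduct D M ν hν) (fun y => UHat.mk D M (a y)) =
      UHat.mk D M fun i => t.eval (M i) fun y => a y i := by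
  induction t with
  | var y => rfl
  | const c => rfl
  | func F ts ih =>
    simp only [Term.eval]
    rw [funext ih]
    exact UHat.func_mk D M F _

theorem Term.eval_ultraproduct_elim {α : Type x} {k : ℕ} (t : Term L (α ⊕ Fin k))
    (a : α → ∀ i, (M i).carrier) (b : Fin k → ∀ i, (M i).carrier) :
    t.eval (ultraproduct D M ν hν)
        (Sum.elim (fun y => UHat.mk D M (a y)) fun j => UHat.mk D M (b j)) =
      UHat.mk D M fun i => t.eval (M i) (Sum.elim (fun y => a y i) fun j => b j i) := by
  have h := t.eval_ultraproduct hν (Sum.elim a b)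
  have h1 : (fun y => UHat.mk D M (Sum.elim a b y)) =
      Sum.elim (fun y => UHat.mk D M (a y)) fun j => UHat.mk D M (b j) := by
    funext y; cases y <;> rfl
  have h2 : ∀ i, (fun y => Sum.elim a b y i) = Sum.elim (fun y => a y i) fun j => b j i := by
    intro i; funext y; cases y <;> rfl
  rw [h1] at h
  simp only [h2] at h
  exact h

theorem snoc_comp {A : Type v} {B : Type w} (g : A → B) {k : ℕ} (b : Fin k → A) (y : A) :
    (fun j => g ((Fin.snoc b y : Fin (k + 1) → A) j)) = Fin.snoc (fun j => g (b j)) (g y) := by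
  funext j
  refine Fin.lastCases ?_ (fun j => ?_) j <;> simp

theorem snoc_eval (i : I) {k : ℕ} (b : Fin k → ∀ i, (M i).carrier) (y : ∀ i, (M i).carrier) :
    (fun j => (Fin.snoc b y : Fin (k + 1) → ∀ i, (M i).carrier) j i) =
      Fin.snoc (fun j => b j i) (y i) :=
  snoc_comp (fun c : ∀ i, (M i).carrier => c i) b y

/-- Łoś's theorem. For `sup`, a nearly optimal point of the ultraproduct gives the lower estimate
through its representing family, and nearly optimal points of the factors give the upper one. For
the integral, continuity allows the passage from `ν` to the measure on the set-theoretic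
ultraproduct. -/
theorem Formula.tendsto_eval (hD : IsCountablyIncomplete D) {α : Type x} {k : ℕ}
    (φ : Formula L α k) (a : α → ∀ i, (M i).carrier) (b : Fin k → ∀ i, (M i).carrier) :
    Tendsto (fun i => φ.eval (M i) (fun y => a y i) fun j => b j i) D
      (𝓝 (φ.eval (ultraproduct D M ν hν) (fun y => UHat.mk D M (a y))
        fun j => UHat.mk D M (b j))) := by
  have hsnoc : ∀ {k : ℕ} {φ : Formula L α (k + 1)} {b : Fin k → ∀ i, (M i).carrier},
      (∀ b : Fin (k + 1) → ∀ i, (M i).carrier,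
        Tendsto (fun i => φ.eval (M i) (fun y => a y i) fun j => b j i) D
          (𝓝 (φ.eval (ultraproduct D M ν hν) (fun y => UHat.mk D M (a y))
            fun j => UHat.mk D M (b j)))) → ∀ y : ∀ i, (M i).carrier,
      Tendsto (fun i => φ.eval (M i) (fun y => a y i) (Fin.snoc (fun j => b j i) (y i))) D
        (𝓝 (φ.eval (ultraproduct D M ν hν) (fun y => UHat.mk D M (a y))
          (Fin.snoc (fun j => UHat.mk D M (b j)) (UHat.mk D M y)))) := by
    intro k φ b h y
    have := h (Fin.snoc b y)
    rw [snoc_comp (UHat.mk D M)] at this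
    simp only [snoc_eval] at this
    exact this
  induction φ with
  | one => exact tendsto_const_nhds
  | rho s t =>
    simp only [Formula.eval]
    rw [s.eval_ultraproduct_elim, t.eval_ultraproduct_elim]
    exact tendsto_dist D M _ _
  | rel R ts =>
    simp only [Formula.eval]
    rw [funext fun j => (ts j).eval_ultraproduct_elim hν a b]
    have := tendsto_rel D M R fun j i =>
      (ts j).eval (M i) (Sum.elim (fun y => a y i) fun j => b j i)
    rw [← UHat.rel_mk] at this
    exact this
  | smul r φ ih => exact (ih b).const_mul r
  | add φ ψ ih1 ih2 => exact (ih1 b).add (ih2 b)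
  | min φ ψ ih1 ih2 => exact (ih1 b).min (ih2 b)
  | sup φ ih =>
    -- Two bounds, because the factors and the ultraproduct live in different universes.
    obtain ⟨C, -, hC⟩ := φ.exists_abs_eval_le (L := L)
    obtain ⟨C', -, hC'⟩ := φ.exists_abs_eval_le (L := L)
    simp only [Formula.eval]
    have hbdd : ∀ i, BddAbove (Set.range fun y : (M i).carrier =>
        φ.eval (M i) (fun y => a y i) (Fin.snoc (fun j => b j i) y)) := fun i =>
      bddAbove_range_of_abs_le fun y => hC (M i) _ _
    have hbdd' : BddAbove (Set.range fun y : (ultraproduct D M ν hν).carrier =>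
        φ.eval (ultraproduct D M ν hν) (fun y => UHat.mk D M (a y))
          (Fin.snoc (fun j => UHat.mk D M (b j)) y)) :=
      bddAbove_range_of_abs_le fun y => hC' (ultraproduct D M ν hν) _ _
    refine tendsto_order.2 ⟨fun r hr => ?_, fun r hr => ?_⟩
    · obtain ⟨y, hy⟩ := exists_lt_of_lt_ciSup hr
      obtain ⟨y, rfl⟩ := UHat.mk_surjective D M y
      filter_upwards [(hsnoc ih y).eventually_const_lt hy] with i hi
      exact hi.trans_le (le_ciSup (hbdd i) (y i))
    · obtain ⟨r', hr', hr'r⟩ := exists_between hr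
      by_contra hcon
      have hex : ∀ᶠ i in (D : Filter I), ∃ y : (M i).carrier,
          r' < φ.eval (M i) (fun y => a y i) (Fin.snoc (fun j => b j i) y) := by
        filter_upwards [Ultrafilter.eventually_not.2 hcon] with i hi
        exact exists_lt_of_lt_ciSup (hr'r.trans_le (not_lt.1 hi))
      choose! y hy using fun (i : I) (h : ∃ y : (M i).carrier,
          r' < φ.eval (M i) (fun y => a y i) (Fin.snoc (fun j => b j i) y)) => h
      have := ge_of_tendsto (hsnoc ih y) (hex.mono fun i hi => (hy i hi).le)
      exact absurd (this.trans (le_ciSup hbdd' (UHat.mk D M y))) (not_le.2 hr')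
  | integral φ ih =>
    obtain ⟨C, -, hC⟩ := φ.exists_abs_eval_le (L := L)
    have hcont := φ.continuous_eval_snoc (ultraproduct D M ν hν) (fun y => UHat.mk D M (a y))
      fun j => UHat.mk D M (b j)
    have heq := hν.integral_eq hD hcont
    simp only [Formula.eval]
    change Tendsto _ _ (𝓝 (∫ y, φ.eval (ultraproduct D M ν hν) (fun y => UHat.mk D M (a y))
      (Fin.snoc (fun j => UHat.mk D M (b j)) y) ∂ν))
    rw [heq]
    exact tendsto_integral_of_forall_tendsto M hD
      (f := fun i y => φ.eval (M i) (fun y => a y i) (Fin.snoc (fun j => b j i) y))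
      (fun i => (φ.continuous_eval_snoc (M i) _ _).measurable)
      (fun i y => hC (M i) _ _) fun y => hsnoc ih y

end ContIntLogic

namespace ContIntLogic

/-! ### A countable dense set of formulas -/

section Countable

variable {L : MMLanguage.{u}} {α : Type v}

/-- The syntax tree of a term. -/
def Term.toWType : Term L α → WType (α := α ⊕ L.Const ⊕ L.Func)
    (fun s => Fin (Sum.elim (fun _ => 0) (Sum.elim (fun _ => 0) L.funcArity) s))
  | .var y => ⟨.inl y, Fin.elim0⟩
  | .const c => ⟨.inr (.inl c), Fin.elim0⟩
  | .func F ts => ⟨.inr (.inr F), fun j => (ts j).toWType⟩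

/-- Well-founded trees with countably many labels and finite branching are countable; the injection
transfers this to terms. -/
theorem Term.toWType_injective : Function.Injective (Term.toWType (L := L) (α := α)) := by
  intro s
  induction s with
  | var y => rintro (_ | _ | _) h <;> cases (WType.mk.inj h).1; rfl
  | const c => rintro (_ | _ | _) h <;> cases (WType.mk.inj h).1; rfl
  | func F ts ih =>
    rintro (_ | _ | _) h <;> cases (WType.mk.inj h).1
    congr 1
    funext j
    exact ih j (congrFun (eq_of_heq (WType.mk.inj h).2) j)

theorem Term.countable (hL : L.IsCountable) [Countable α] : Countable (Term L α) := by
  have := hL.1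
  have := hL.2.1
  have := Encodable.ofCountable α
  have := Encodable.ofCountable L.Const
  have := Encodable.ofCountable L.Func
  exact Term.toWType_injective.countable

variable (L α) in
/-- The formulas of depth less than `d` all of whose scalars are rational. -/
def ratFormulas : ℕ → ∀ k, Set (Formula L α k)
  | 0, _ => ∅
  | d + 1, k => ratFormulas d k ∪ ({.one} ∪ (Set.range (fun p : _ × _ => .rho p.1 p.2) ∪
      (Set.range (fun p : Σ R : L.Rel, (Fin (L.relArity R) → Term L (α ⊕ Fin k)) =>
        .rel p.1 p.2) ∪
      (Set.range (fun p : ℚ × ratFormulas d k => .smul p.1 p.2.1) ∪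
      (Set.image2 .add (ratFormulas d k) (ratFormulas d k) ∪
      (Set.image2 .min (ratFormulas d k) (ratFormulas d k) ∪
      (.sup '' ratFormulas d (k + 1) ∪ .integral '' ratFormulas d (k + 1))))))))

theorem countable_ratFormulas (hL : L.IsCountable) [Countable α] (d k : ℕ) :
    (ratFormulas L α d k).Countable := by
  have := hL.2.2
  have hT : ∀ k, Countable (Term L (α ⊕ Fin k)) := fun k => Term.countable hL
  induction d generalizing k with
  | zero => exact Set.countable_empty
  | succ d ih =>
    have := (ih k).to_subtype
    exact (ih k).union <| (Set.countable_singleton _).union <| (Set.countable_range _).union <|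
      (Set.countable_range _).union <| (Set.countable_range _).union <|
      ((ih k).image2 (ih k) _).union <| ((ih k).image2 (ih k) _).union <|
      ((ih (k + 1)).image _).union ((ih (k + 1)).image _)

theorem ratFormulas_mono (k : ℕ) : Monotone fun d => ratFormulas L α d k :=
  monotone_nat_of_le_succ fun _ => Set.subset_union_left

/-- All connectives and quantifiers are uniformly continuous in their arguments, the integral
because the total mass is at most one. Only scalar multiplication needs care: the error splits into
the change of scalar, controlled by a bound on `φ`, and the change of formula, controlled by the new
scalar. -/
theorem Formula.exists_ratFormula (M : MMStructure.{u, w} L) {k : ℕ} (φ : Formula L α k) {ε : ℝ}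
    (hε : 0 < ε) : ∃ d, ∃ ψ ∈ ratFormulas L α d k, ∀ (a : α → M.carrier) (b : Fin k → M.carrier),
      |φ.eval M a b - ψ.eval M a b| ≤ ε := by
  induction φ generalizing ε with
  | one => exact ⟨1, .one, by simp [ratFormulas], fun a b => by simpa using hε.le⟩
  | rho s t => exact ⟨1, .rho s t, by simp [ratFormulas], fun a b => by simpa using hε.le⟩
  | rel R ts =>
    refine ⟨1, .rel R ts, ?_, fun a b => by simpa using hε.le⟩
    exact .inr (.inr (.inr (.inl ⟨⟨R, ts⟩, rfl⟩)))
  | smul r φ ih =>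
    obtain ⟨C, hC, hφ⟩ := φ.exists_abs_eval_le (L := L)
    -- The `+ 1` in both denominators covers the cases `C = 0` and `q = 0`.
    obtain ⟨q, hq, hq'⟩ := exists_rat_btwn (show r < r + ε / (2 * (C + 1)) by
      have : 0 < ε / (2 * (C + 1)) := by positivity
      linarith)
    have hη : 0 < ε / (2 * (|(q : ℝ)| + 1)) := by positivity
    obtain ⟨d, ψ, hψ, h⟩ := ih hη
    refine ⟨d + 1, .smul q ψ, .inr (.inr (.inr (.inr (.inl ⟨⟨q, ψ, hψ⟩, rfl⟩)))), fun a b => ?_⟩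
    simp only [Formula.eval]
    have h1 : |(r - q) * φ.eval M a b| ≤ ε / 2 := by
      rw [abs_mul]
      calc |r - q| * |φ.eval M a b| ≤ ε / (2 * (C + 1)) * (C + 1) := by
            refine mul_le_mul ?_ ((hφ M a b).trans (by linarith)) (abs_nonneg _) (by positivity)
            rw [abs_le]; constructor <;> linarith
        _ = ε / 2 := by field_simp
    have h2 : |q * (φ.eval M a b - ψ.eval M a b)| ≤ ε / 2 := by
      rw [abs_mul]
      calc |(q : ℝ)| * |φ.eval M a b - ψ.eval M a b|
          ≤ (|(q : ℝ)| + 1) * (ε / (2 * (|(q : ℝ)| + 1))) := by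
            refine mul_le_mul (by linarith) (h a b) (abs_nonneg _) (by positivity)
        _ = ε / 2 := by field_simp
    calc |r * φ.eval M a b - q * ψ.eval M a b|
        = |(r - q) * φ.eval M a b + q * (φ.eval M a b - ψ.eval M a b)| := by ring_nf
      _ ≤ ε / 2 + ε / 2 := (abs_add_le _ _).trans (add_le_add h1 h2)
      _ = ε := add_halves ε
  | add φ φ' ih ih' =>
    obtain ⟨d, ψ, hψ, h⟩ := ih (half_pos hε)
    obtain ⟨d', ψ', hψ', h'⟩ := ih' (half_pos hε)
    refine ⟨max d d' + 1, .add ψ ψ', .inr (.inr (.inr (.inr (.inr (.inl ⟨ψ,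
      ratFormulas_mono _ (le_max_left d d') hψ, ψ', ratFormulas_mono _ (le_max_right d d') hψ',
      rfl⟩))))), fun a b => ?_⟩
    simp only [Formula.eval]
    rw [add_sub_add_comm, ← add_halves ε]
    exact (abs_add_le _ _).trans (add_le_add (h a b) (h' a b))
  | min φ φ' ih ih' =>
    obtain ⟨d, ψ, hψ, h⟩ := ih hε
    obtain ⟨d', ψ', hψ', h'⟩ := ih' hε
    refine ⟨max d d' + 1, .min ψ ψ', .inr (.inr (.inr (.inr (.inr (.inr (.inl ⟨ψ,
      ratFormulas_mono _ (le_max_left d d') hψ, ψ', ratFormulas_mono _ (le_max_right d d') hψ',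
      rfl⟩)))))), fun a b => ?_⟩
    exact (abs_min_sub_min_le_max _ _ _ _).trans (max_le (h a b) (h' a b))
  | sup φ ih =>
    obtain ⟨d, ψ, hψ, h⟩ := ih hε
    obtain ⟨C, -, hC⟩ := φ.exists_abs_eval_le (L := L)
    obtain ⟨C', -, hC'⟩ := ψ.exists_abs_eval_le (L := L)
    refine ⟨d + 1, .sup ψ, .inr (.inr (.inr (.inr (.inr (.inr (.inr (.inl ⟨ψ, hψ, rfl⟩))))))),
      fun a b => ?_⟩
    exact abs_ciSup_sub_ciSup_le (bddAbove_range_of_abs_le fun y => hC M _ _)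
      (bddAbove_range_of_abs_le fun y => hC' M _ _) fun y => h a _
  | integral φ ih =>
    obtain ⟨d, ψ, hψ, h⟩ := ih hε
    refine ⟨d + 1, .integral ψ, .inr (.inr (.inr (.inr (.inr (.inr (.inr (.inr
      ⟨ψ, hψ, rfl⟩))))))), fun a b => ?_⟩
    exact abs_integral_sub_le M.measureReal_univ_le (φ.integrable_eval_snoc M a b)
      (ψ.integrable_eval_snoc M a b) hε.le fun y => h a _

/-- The error up to which a statement holds. -/
noncomputable def Condition.defect (M : MMStructure.{u, w} L) (a : α → M.carrier) :
    Condition L α → ℝ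
  | .eq φ ψ => |φ.eval M a Fin.elim0 - ψ.eval M a Fin.elim0|
  | .le φ ψ => φ.eval M a Fin.elim0 - ψ.eval M a Fin.elim0

theorem Condition.holdsUpTo_iff (M : MMStructure.{u, w} L) (a : α → M.carrier)
    (σ : Condition L α) (ε : ℝ) : σ.HoldsUpTo M ε a ↔ σ.defect M a ≤ ε := by
  cases σ with
  | eq φ ψ => exact Iff.rfl
  | le φ ψ => exact sub_le_iff_le_add'.symm

theorem Condition.holds_of_defect_nonpos {M : MMStructure.{u, w} L} {a : α → M.carrier}
    {σ : Condition L α} (h : σ.defect M a ≤ 0) : σ.Holds M a := by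
  cases σ with
  | eq φ ψ => exact sub_eq_zero.1 (abs_nonpos_iff.1 h)
  | le φ ψ => exact sub_nonpos.1 h

variable (L α) in
/-- The statements about formulas all of whose scalars are rational. -/
def ratConditions : Set (Condition L α) :=
  Set.image2 .eq (⋃ d, ratFormulas L α d 0) (⋃ d, ratFormulas L α d 0) ∪
    Set.image2 .le (⋃ d, ratFormulas L α d 0) (⋃ d, ratFormulas L α d 0)

theorem countable_ratConditions (hL : L.IsCountable) [Countable α] :
    (ratConditions L α).Countable := by
  have h := Set.countable_iUnion fun d => countable_ratFormulas (α := α) hL d 0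
  exact (h.image2 h _).union (h.image2 h _)

theorem Condition.exists_ratCondition (M : MMStructure.{u, w} L) (σ : Condition L α) {ε : ℝ}
    (hε : 0 < ε) : ∃ τ ∈ ratConditions L α, ∀ a : α → M.carrier,
      |σ.defect M a - τ.defect M a| ≤ ε := by
  have key : ∀ x y x' y' : ℝ, |x - x'| ≤ ε / 2 → |y - y'| ≤ ε / 2 →
      |(x - y) - (x' - y')| ≤ ε := fun x y x' y' h h' => by
    rw [abs_le] at *; constructor <;> linarith
  cases σ with
  | eq φ ψ =>
    obtain ⟨d, φ', hφ', h⟩ := φ.exists_ratFormula M (half_pos hε)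
    obtain ⟨d', ψ', hψ', h'⟩ := ψ.exists_ratFormula M (half_pos hε)
    refine ⟨.eq φ' ψ', .inl ⟨φ', Set.mem_iUnion.2 ⟨d, hφ'⟩, ψ', Set.mem_iUnion.2 ⟨d', hψ'⟩, rfl⟩,
      fun a => ?_⟩
    exact (abs_abs_sub_abs_le_abs_sub _ _).trans (key _ _ _ _ (h a _) (h' a _))
  | le φ ψ =>
    obtain ⟨d, φ', hφ', h⟩ := φ.exists_ratFormula M (half_pos hε)
    obtain ⟨d', ψ', hψ', h'⟩ := ψ.exists_ratFormula M (half_pos hε)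
    exact ⟨.le φ' ψ', .inr ⟨φ', Set.mem_iUnion.2 ⟨d, hφ'⟩, ψ', Set.mem_iUnion.2 ⟨d', hψ'⟩, rfl⟩,
      fun a => key _ _ _ _ (h a _) (h' a _)⟩

end Countable

/-! ### Saturation -/

theorem Condition.tendsto_defect {L : MMLanguage.{u}} {I : Type v} {D : Ultrafilter I}
    {M : I → MMStructure.{u, w} L} {ν : Measure (UHat D M)} (hν : IsUltraproductMeasure D M ν)
    (hD : IsCountablyIncomplete D) {α : Type x} (σ : Condition L α)
    (a : α → ∀ i, (M i).carrier) :
    Tendsto (fun i => σ.defect (M i) fun y => a y i) D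
      (𝓝 (σ.defect (ultraproduct D M ν hν) fun y => UHat.mk D M (a y))) := by
  have h : ∀ φ : Formula L α 0, Tendsto
      (fun i => φ.eval (M i) (fun y => a y i) Fin.elim0) D
      (𝓝 (φ.eval (ultraproduct D M ν hν) (fun y => UHat.mk D M (a y)) Fin.elim0)) := by
    intro φ
    have h := φ.tendsto_eval hν hD a Fin.elim0
    rw [Subsingleton.elim (fun j : Fin 0 => UHat.mk D M (Fin.elim0 j)) Fin.elim0] at h
    refine h.congr fun i => ?_
    rw [Subsingleton.elim (fun j : Fin 0 => _) Fin.elim0]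
  cases σ with
  | eq φ ψ => exact ((h φ).sub (h ψ)).abs
  | le φ ψ => exact (h φ).sub (h ψ)

end ContIntLogic

open ContIntLogic in
/-- The metric-measure ultraproduct of structures in a countable language along a countably
incomplete ultrafilter is `ℵ₁`-saturated. -/
theorem proposition4p14 {L : ContIntLogic.MMLanguage.{u}} (hL : L.IsCountable)
    {I : Type v} (D : Ultrafilter I) (hD : ContIntLogic.IsCountablyIncomplete D)
    (M : I → ContIntLogic.MMStructure.{u, w} L)
    (ν : Measure (ContIntLogic.UHat D M)) (hν : ContIntLogic.IsUltraproductMeasure D M ν) :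
    ContIntLogic.IsSaturated (Cardinal.aleph 1) (ContIntLogic.ultraproduct D M ν hν) := by
  classical
  intro A hA n p hp
  have : Countable A := (Cardinal.le_aleph0_iff_set_countable.1
    (Order.lt_succ_iff.1 (by rwa [Cardinal.succ_aleph0]))).to_subtype
  have := (countable_ratConditions (α := A ⊕ Fin n) hL).to_subtype
  let N := ultraproduct D M ν hν
  -- Parameters have no meaning in the factors, so each is replaced by the coordinates of a
  -- representing family.
  let r : A → ∀ i, (M i).carrier := fun y => UHat.rep D M y.1
  have hassign : ∀ b : Fin n → ∀ i, (M i).carrier,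
      (fun y => UHat.mk D M (Sum.elim r b y)) =
        Sum.elim (fun y : A => (y : N.carrier)) fun j => UHat.mk D M (b j) := fun b => by
    funext y
    cases y with
    | inl y => exact UHat.mk_rep D M y.1
    | inr j => rfl
  have heval : ∀ (b : Fin n → ∀ i, (M i).carrier) (i : I), (fun y => Sum.elim r b y i) =
      Sum.elim (fun y => r y i) fun j => b j i := fun b i => by
    funext y
    cases y <;> rfl
  have hpos : ∀ m : ℕ, 0 < 1 / ((m : ℝ) + 1) := fun m => Nat.one_div_pos_of_nat
  -- rational statements that are close to a statement of the type, with their distance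
  let K := {q : ratConditions L (A ⊕ Fin n) × ℕ //
    ∃ σ ∈ p, ∀ a : A ⊕ Fin n → N.carrier, |σ.defect N a - q.1.1.defect N a| ≤ 1 / ((q.2 : ℝ) + 1)}
  -- In the ultraproduct `τ` has defect at most `2 / (m + 1)`: one share for its distance to `σ`,
  -- one for the approximate realization of `σ`. The constant `3` makes this strict, so that it
  -- passes to almost all factors.
  obtain ⟨b, hb⟩ := hD.exists_family (ι := K) (X := fun i => Fin n → (M i).carrier)
    (fun q i b => q.1.1.1.defect (M i) (Sum.elim (fun y => r y i) b) ≤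
      3 * (1 / ((q.1.2 : ℝ) + 1))) (by
    intro s
    choose σ hσp hσ using fun q : K => q.2
    obtain ⟨b, hb⟩ := hp (s.image σ) (by
      intro τ hτ
      obtain ⟨q, -, rfl⟩ := Finset.mem_image.1 (Finset.mem_coe.1 hτ)
      -- The tolerance is the smallest required by a member of `s`.
      exact hσp q) (1 / (((s.sup fun q => q.1.2 : ℕ) : ℝ) + 1)) (hpos _)
    obtain ⟨c, rfl⟩ : ∃ c : Fin n → ∀ i, (M i).carrier, b = fun j => UHat.mk D M (c j) :=
      ⟨fun j => UHat.rep D M (b j), funext fun j => (UHat.mk_rep D M (b j)).symm⟩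
    have hev : ∀ q ∈ s, ∀ᶠ i in (D : Filter I), q.1.1.1.defect (M i)
        (Sum.elim (fun y => r y i) fun j => c j i) <
          3 * (1 / ((q.1.2 : ℝ) + 1)) := by
      intro q hq
      have hlim := q.1.1.1.tendsto_defect hν hD (Sum.elim r c)
      simp only [heval] at hlim
      refine hlim.eventually_lt_const ?_
      rw [hassign]
      have h1 := (Condition.holdsUpTo_iff _ _ _ _).1 (hb _ (Finset.mem_image_of_mem σ hq))
      have h2 := (abs_le.1 (hσ q (Sum.elim (fun y : A => (y : N.carrier))
        fun j => UHat.mk D M (c j)))).1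
      have h3 : 1 / (((s.sup fun q => q.1.2 : ℕ) : ℝ) + 1) ≤ 1 / ((q.1.2 : ℝ) + 1) := by
        have : q.1.2 ≤ s.sup fun q => q.1.2 := Finset.le_sup (f := fun q : K => q.1.2) hq
        gcongr
      have h4 := hpos q.1.2
      have h5 : Condition.defect N (Sum.elim (fun y : A => (y : N.carrier))
          fun j => UHat.mk D M (c j)) q.1.1.1 <
          3 * (1 / ((q.1.2 : ℝ) + 1)) := by linarith
      exact h5
    filter_upwards [(Filter.eventually_all_finset s).2 hev] with i hi
    exact ⟨fun j => c j i, fun q hq => (hi q hq).le⟩)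
  refine ⟨fun j => UHat.mk D M fun i => b i j, fun σ hσ => Condition.holds_of_defect_nonpos ?_⟩
  -- The defect of `σ` is at most `3 / (m + 1)` for its approximation plus `1 / (m + 1)` for their
  -- distance, for every `m`.
  refine le_of_tendsto_of_tendsto' (f := fun _ : ℕ => _) (b := atTop)
    (g := fun m : ℕ => 4 * (1 / ((m : ℝ) + 1))) tendsto_const_nhds
    (by simpa using tendsto_one_div_add_atTop_nhds_zero_nat.const_mul (4 : ℝ)) fun m => ?_
  obtain ⟨τ, hτ, hστ⟩ := σ.exists_ratCondition N (hpos m)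
  have hlim := τ.tendsto_defect hν hD (Sum.elim r fun j i => b i j)
  rw [hassign] at hlim
  simp only [heval] at hlim
  have h1 := le_of_tendsto hlim (hb ⟨⟨⟨τ, hτ⟩, m⟩, σ, hσ, hστ⟩)
  have h2 := (abs_le.1 (hστ (Sum.elim (fun y : A => (y : N.carrier))
    fun j => UHat.mk D M fun i => b i j))).2
  have h3 : Condition.defect N (Sum.elim (fun y : A => (y : N.carrier))
    fun j => UHat.mk D M fun i => b i j) τ ≤ 3 * (1 / ((m : ℝ) + 1)) := h1
  have h4 : Condition.defect N (Sum.elim (fun y : A => (y : N.carrier))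
    fun j => UHat.mk D M fun i => b i j) σ ≤ 4 * (1 / ((m : ℝ) + 1)) := by linarith
  exact h4
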